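/- Let $N\in\mathbb N$, $p>1$, $\gamma\in[0,1]$, $s\in(0,1]$ with $1/p<s<N/p$, and, if $\gamma>0$, also $p<N$. Let $\alpha>-sp$, $\beta>p(1-s)$, and put $$p^*_{\gamma,s,\alpha}=\frac{p(N+\alpha)}{N-sp}\ \text{ if }\gamma=0,\qquad p^*_{\gamma,s,\alpha}=\frac{p(N+\alpha)}{N-p}\ \text{ if }\gamma\in(0,1].$$ Write $\Phi_m(t)=|t|^{m-2}t$ for $m>1$ and $t$ a number or a vector, with $\Phi_m(0)=0$. For $\sigma\in(0,1]$ let $W^{\sigma,p}_{\mathrm{rad},\beta}(\mathbb R^N)$ be the space of radial measurable functions $u:\mathbb R^N\to\mathbb R$ with $\int_{\mathbb R^N}|x|^\beta|u|^p\,dx<\infty$ and $[u]_{\sigma,p}<\infty$, where $$[u]_{\sigma,p}^p=\iint_{\mathbb R^N\times\mathbb R^N}\frac{|u(x)-u(y)|^p}{|x-y|^{N+\sigma p}}\,dx\,dy\ \text{ if }\sigma<1,\qquad [u]_{1,p}^p=\int_{\mathbb R^N}|\nabla u|^p\,dx$$ with $\nabla u$ the weak gradient. Let $\mathcal W=W^{s,p}_{\mathrm{rad},\beta}(\mathbb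 R^N)$ if $\gamma=0$ and $\mathcal W=W^{1,p}_{\mathrm{rad},\beta}(\mathbb R^N)$ if $\gamma\in(0,1]$. A weak solution of $$\gamma(-\Delta_p)u+(1-\gamma)(-\Delta_p)^su+|x|^\beta|u|^{p-2}u=|x|^\alpha|u|^{q-2}u\quad\text{in }\mathbb R^N$$ is a function $u\in\mathcal W$ such that for every $v\in\mathcal W$ the following integrals converge absolutely (those with coefficient $0$ being omitted) and $$\gamma\int_{\mathbb R^N}\Phi_p(\nabla u)\cdot\nabla v\,dx+(1-\gamma)\iint_{\mathbb R^N\times\mathbb R^N}\frac{\Phi_p(u(x)-u(y))(v(x)-v(y))}{|x-y|^{N+sp}}\,dx\,dy+\int_{\mathbb R^N}|x|^\beta\Phi_p(u)v\,dx=\int_{\mathbb R^N}|x|^\alpha\Phi_q(u)v\,dx,$$ where for $s=1$ the double integral is replaced by $\int_{\mathbb R^N}\Phi_p(\nabla u)\cdot\nabla v\,dx$. Then for every $q>p^*_{\gamma,s,\alpha}$ the only weak solution $u\in\mathcal W\cap L^\infty(\mathbb R^N)$ that has a (locally integrable) weak gradient with $|\nabla u(x)|\,|x|\in L^r(\mathbb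 R^N)$ for some $r\in(1,\infty]$ is $u=0$ a.e. In particular, there is no such solution with $u>0$. -/

import Mathlib

open MeasureTheory
open scoped ENNReal ContDiff

noncomputable section

namespace MixedHenon

/-- The Euclidean space `ℝ^N`. -/
abbrev E (N : ℕ) : Type := EuclideanSpace ℝ (Fin N)

/-- `G` is a weak (distributional) gradient of `u` on `ℝ^N`. -/
def IsWeakGradient {N : ℕ} (u : E N → ℝ) (G : E N → E N) : Prop :=
  LocallyIntegrable u volume ∧ LocallyIntegrable G volume ∧
    ∀ φ : E N → ℝ, ContDiff ℝ ∞ φ → HasCompactSupport φ → ∀ e : E N,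
      ∫ x, u x * fderiv ℝ φ x e = -∫ x, φ x * inner ℝ (G x) e

/-- `u` has a weak gradient that is a locally integrable function. -/
def HasWeakGradient {N : ℕ} (u : E N → ℝ) : Prop := ∃ G : E N → E N, IsWeakGradient u G

open Classical in
/-- The weak gradient `∇u` (unique up to null sets); the junk value `0` is only taken
when no weak gradient exists. -/
def weakGrad {N : ℕ} (u : E N → ℝ) : E N → E N :=
  if h : HasWeakGradient u then h.choose else 0

/-- `Φ_p(t) = |t|^{p-2} t`, for numbers. -/
def Phi (p t : ℝ) : ℝ := |t| ^ (p - 2) * t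

/-- `Φ_p(ξ) = |ξ|^{p-2} ξ`, for vectors. -/
def PhiVec {N : ℕ} (p : ℝ) (ξ : E N) : E N := ‖ξ‖ ^ (p - 2) • ξ

/-- `u ∈ L^p_β(ℝ^N)`: `u` is measurable and `∫ |x|^β |u|^p dx < ∞`. -/
def MemWeightedLp {N : ℕ} (p β : ℝ) (u : E N → ℝ) : Prop :=
  AEStronglyMeasurable u volume ∧ Integrable (fun x : E N => ‖x‖ ^ β * |u x| ^ p) volume

/-- `[u]_{s,p} < ∞`, where `[u]_{s,p}` is the Gagliardo seminorm for `s < 1`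
and the `L^p` norm of the weak gradient for `s = 1`. -/
def FiniteSeminorm {N : ℕ} (s p : ℝ) (u : E N → ℝ) : Prop :=
  if s = 1 then HasWeakGradient u ∧ MemLp (weakGrad u) (ENNReal.ofReal p) volume
  else Integrable (fun z : E N × E N => |u z.1 - u z.2| ^ p / ‖z.1 - z.2‖ ^ ((N : ℝ) + s * p))
    (volume.prod volume)

/-- The weighted fractional Sobolev space `W^{s,p}_β(ℝ^N)`. -/
def MemW {N : ℕ} (s p β : ℝ) (u : E N → ℝ) : Prop :=
  MemWeightedLp p β u ∧ FiniteSeminorm s p u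

/-- `u` is radial, i.e. (as a class of functions modulo null sets) a function of `|x|`. -/
def IsRadial {N : ℕ} (u : E N → ℝ) : Prop :=
  ∃ g : ℝ → ℝ, u =ᵐ[volume] fun x => g ‖x‖

/-- The space `𝒲^{s,p}_β(ℝ^N)` of the variational framework: the radial functions of
`W^{s,p}_β(ℝ^N)` if `γ = 0`, and those of `W^{1,p}_β(ℝ^N)` otherwise. -/
def MemCalW {N : ℕ} (γ s p β : ℝ) (u : E N → ℝ) : Prop :=
  MemW (if γ = 0 then s else 1) p β u ∧ IsRadial u

/-- The integrand of `⟨-Δ_p u, v⟩`. -/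
def localIntegrand {N : ℕ} (p : ℝ) (u v : E N → ℝ) (x : E N) : ℝ :=
  inner ℝ (PhiVec p (weakGrad u x)) (weakGrad v x)

/-- The integrand of `⟨(-Δ_p)^s u, v⟩` for `s < 1`. -/
def nonlocalIntegrand {N : ℕ} (s p : ℝ) (u v : E N → ℝ) (z : E N × E N) : ℝ :=
  Phi p (u z.1 - u z.2) * (v z.1 - v z.2) / ‖z.1 - z.2‖ ^ ((N : ℝ) + s * p)

/-- The pairing `⟨(-Δ_p)^s u, v⟩` for `s ∈ (0,1]`, with `(-Δ_p)^1 = -Δ_p`. -/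
def fracPairing {N : ℕ} (s p : ℝ) (u v : E N → ℝ) : ℝ :=
  if s = 1 then ∫ x, localIntegrand p u v x
  else ∫ z, nonlocalIntegrand s p u v z ∂(volume.prod volume)

/-- The integral in `fracPairing` converges absolutely. -/
def FracPairingConverges {N : ℕ} (s p : ℝ) (u v : E N → ℝ) : Prop :=
  if s = 1 then Integrable (localIntegrand p u v) volume
  else Integrable (nonlocalIntegrand s p u v) (volume.prod volume)

/-- The pairing `⟨ℒ_{s,p,γ} u, v⟩`, where `ℒ_{s,p,γ} = γ (-Δ_p) + (1 - γ) (-Δ_p)^s`. -/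
def opPairing {N : ℕ} (γ s p : ℝ) (u v : E N → ℝ) : ℝ :=
  γ * (∫ x, localIntegrand p u v x) + (1 - γ) * fracPairing s p u v

/-- The integrals that occur in `opPairing` with a nonzero coefficient converge absolutely. -/
def OpPairingConverges {N : ℕ} (γ s p : ℝ) (u v : E N → ℝ) : Prop :=
  (γ ≠ 0 → Integrable (localIntegrand p u v) volume) ∧
    (γ ≠ 1 → FracPairingConverges s p u v)

/-- `u` is a weak solution of
`ℒ_{s,p,γ} u + |x|^β |u|^{p-2} u = |x|^α |u|^{q-2} u` in `ℝ^N`: `u ∈ 𝒲^{s,p}_β(ℝ^N)` and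
for every `v ∈ 𝒲^{s,p}_β(ℝ^N)` the integrals of the weak formulation exist and satisfy it.
No sign is imposed on `u`. -/
def IsWeakSolution {N : ℕ} (γ s p q α β : ℝ) (u : E N → ℝ) : Prop :=
  MemCalW γ s p β u ∧ ∀ v : E N → ℝ, MemCalW γ s p β v →
    OpPairingConverges γ s p u v ∧
    Integrable (fun x : E N => ‖x‖ ^ β * Phi p (u x) * v x) volume ∧
    Integrable (fun x : E N => ‖x‖ ^ α * Phi q (u x) * v x) volume ∧
    opPairing γ s p u v + ∫ x : E N, ‖x‖ ^ β * Phi p (u x) * v x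
      = ∫ x : E N, ‖x‖ ^ α * Phi q (u x) * v x

/-- The class of all `u ∈ 𝒲^{s,p}_β(ℝ^N) ∩ L^∞(ℝ^N)` such that
`|∇u(x)| |x| ∈ L^r(ℝ^N)` for some `r > 1`. -/
def MemX {N : ℕ} (γ s p β : ℝ) (u : E N → ℝ) : Prop :=
  MemCalW γ s p β u ∧ MemLp u ∞ volume ∧ HasWeakGradient u ∧
    ∃ r : ℝ≥0∞, 1 < r ∧ MemLp (fun x : E N => ‖weakGrad u x‖ * ‖x‖) r volume

/-- The critical exponent `p*_{γ,s,α}`. -/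
def critExp (N : ℕ) (γ s p α : ℝ) : ℝ :=
  if γ = 0 then p * ((N : ℝ) + α) / ((N : ℝ) - s * p) else p * ((N : ℝ) + α) / ((N : ℝ) - p)

end MixedHenon

end

/-! The proof tests the equation with `u_t = u ∘ φ_t⁻¹`, where `φ_t x = (1 - t) x` on a large
annulus and the radial field `x` is cut off near `0` and near infinity at scale `R`; the cut-offs
are rescaled copies of one another, so all constants are uniform in `R`, and the transported `u_t`
stays radial and in the solution space. As `t → 0` and then `R → ∞` the weighted, Gagliardo and
Dirichlet energies of `u_t` have the slopes `-(N + β)`, `-(N - sp)` and `-(N - p)` of a genuine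
dilation, and convexity of `|·|^p` bounds `p` times each pairing of `u` with `u_t - u` by the
increment of the corresponding energy. For the source term convexity goes the wrong way, at the
cost of a remainder `∫ |x|^α |Φ_q(u_t) - Φ_q(u)| |u_t - u|`; this is `o(t)` because `u` is bounded
and has a weak gradient. With `A` the source integral, `B` the weighted `L^p` term and `L` the
diffusion energy, the outcome is the Pohozaev inequality
`(N - σp)/p * L + (N + β)/p * B ≤ (N + α)/q * A`, where `σ = s` if `γ = 0` and `σ = 1` otherwise.
Combined with `L + B = A` and `q` supercritical it forces `A = 0`. -/

namespace MixedHenon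

open Filter Topology
open scoped NNReal

noncomputable section

section Mollification

variable {V : Type*} [NormedAddCommGroup V]

/-- The filter of bump functions at `0` whose support shrinks to the origin. -/
def smallBumps (V : Type*) [NormedAddCommGroup V] : Filter (ContDiffBump (0 : V)) :=
  comap ContDiffBump.rOut (𝓝 0)

lemma eventually_rOut_lt {δ : ℝ} (hδ : 0 < δ) : ∀ᶠ φ in smallBumps V, φ.rOut < δ :=
  (eventually_lt_nhds hδ).comap _

instance smallBumps_neBot : (smallBumps V).NeBot :=
  comap_neBot fun t ht => by
    obtain ⟨δ, hδ, hball⟩ := Metric.mem_nhds_iff.1 ht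
    refine ⟨⟨δ / 3, δ / 2, by positivity, by linarith⟩, hball ?_⟩
    rw [Metric.mem_ball, Real.dist_0_eq_abs, abs_of_pos] <;> linarith

variable [NormedSpace ℝ V] [HasContDiffBump V] [MeasurableSpace V] {F : Type*}
  [NormedAddCommGroup F] [NormedSpace ℝ F] {μ : Measure V}

/-- The mollification of `f` by the bump function `φ`, normalized to have integral `1`. -/
def mollify (μ : Measure V) (φ : ContDiffBump (0 : V)) (f : V → F) : V → F :=
  convolution (φ.normed μ) f (ContinuousLinearMap.lsmul ℝ ℝ) μ

lemma mollify_apply (φ : ContDiffBump (0 : V)) (f : V → F) (x : V) :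
    mollify μ φ f x = ∫ t, φ.normed μ t • f (x - t) ∂μ := rfl

variable [BorelSpace V] [FiniteDimensional ℝ V] [μ.IsAddHaarMeasure]

lemma mollify_eq_of_eqOn_ball {φ : ContDiffBump (0 : V)} {f g : V → F} {x : V}
    (h : Set.EqOn f g (Metric.ball x φ.rOut)) : mollify μ φ f x = mollify μ φ g x := by
  refine integral_congr_ae (Eventually.of_forall fun t => ?_)
  by_cases ht : φ.normed μ t = 0
  · simp [ht]
  · have ht' : t ∈ Function.support (φ.normed μ) := ht
    rw [φ.support_normed_eq, mem_ball_zero_iff] at ht'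
    have hxt : x - t ∈ Metric.ball x φ.rOut := by simpa [dist_eq_norm] using ht'
    simp only [h hxt]

lemma integrable_normed_smul_comp_sub (φ : ContDiffBump (0 : V)) {f : V → F}
    (hf : LocallyIntegrable f μ) (x : V) : Integrable (fun t => φ.normed μ t • f (x - t)) μ :=
  φ.hasCompactSupport_normed.convolutionExists_left (ContinuousLinearMap.lsmul ℝ ℝ)
    φ.continuous_normed hf x

lemma mollify_sub (φ : ContDiffBump (0 : V)) {f g : V → F} (hf : LocallyIntegrable f μ)
    (hg : LocallyIntegrable g μ) : mollify μ φ (f - g) = mollify μ φ f - mollify μ φ g := by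
  ext x
  simp only [mollify_apply, Pi.sub_apply, smul_sub]
  exact integral_sub (integrable_normed_smul_comp_sub φ hf x)
    (integrable_normed_smul_comp_sub φ hg x)

lemma contDiff_mollify (φ : ContDiffBump (0 : V)) {f : V → F} (hf : LocallyIntegrable f μ) :
    ContDiff ℝ ∞ (mollify μ φ f) :=
  φ.hasCompactSupport_normed.contDiff_convolution_left (n := ⊤) _ φ.contDiff_normed hf

lemma integrable_mollify (φ : ContDiffBump (0 : V)) {f : V → F} (hf : Integrable f μ) :
    Integrable (mollify μ φ f) μ :=
  φ.integrable_normed.integrable_convolution _ hf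

lemma integral_norm_mollify_le (φ : ContDiffBump (0 : V)) {f : V → F}
    (hf : Integrable f μ) : ∫ x, ‖mollify μ φ f x‖ ∂μ ≤ ∫ x, ‖f x‖ ∂μ := by
  have hpt : ∀ x, ‖mollify μ φ f x‖ ≤ mollify μ φ (fun y => ‖f y‖) x := fun x =>
    (norm_integral_le_integral_norm _).trans_eq <| integral_congr_ae <|
      Eventually.of_forall fun t => by simp [norm_smul, abs_of_nonneg (φ.nonneg_normed t)]
  calc ∫ x, ‖mollify μ φ f x‖ ∂μ ≤ ∫ x, mollify μ φ (fun y => ‖f y‖) x ∂μ :=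
        integral_mono (integrable_mollify φ hf).norm (integrable_mollify φ hf.norm) hpt
    _ = ∫ x, ‖f x‖ ∂μ := by
        unfold mollify
        rw [integral_convolution _ φ.integrable_normed hf.norm, φ.integral_normed]
        simp

lemma eventually_norm_mollify_sub_le_of_uniformContinuous [CompleteSpace F] {g : V → F}
    (hg : UniformContinuous g) {ε : ℝ} (hε : 0 < ε) :
    ∀ᶠ φ in smallBumps V, ∀ x, ‖mollify μ φ g x - g x‖ ≤ ε := by
  obtain ⟨δ, hδ, h⟩ := Metric.uniformContinuous_iff.1 hg ε hε
  filter_upwards [eventually_rOut_lt hδ] with φ hφ x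
  rw [← dist_eq_norm]
  exact ContDiffBump.dist_normed_convolution_le hg.continuous.aestronglyMeasurable
    fun y hy => (h ((Metric.mem_ball.1 hy).trans hφ)).le

lemma setIntegral_norm_mollify_sub_le [CompleteSpace F] (φ : ContDiffBump (0 : V)) {f g : V → F}
    (hf : Integrable f μ) (hg : Integrable g μ) (K : Set V) :
    ∫ x in K, ‖mollify μ φ f x - f x‖ ∂μ ≤
      2 * ∫ x, ‖f x - g x‖ ∂μ + ∫ x in K, ‖mollify μ φ g x - g x‖ ∂μ := by
  have hfg : Integrable (f - g) μ := hf.sub hg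
  have hmfg := (integrable_mollify φ hfg).norm
  have hsum : Integrable (fun x => ‖mollify μ φ (f - g) x‖ + ‖(f - g) x‖) μ := hmfg.add hfg.norm
  have hmf : Integrable (fun x => ‖mollify μ φ f x - f x‖) μ :=
    ((integrable_mollify φ hf).sub hf).norm
  have hmg : Integrable (fun x => ‖mollify μ φ g x - g x‖) μ :=
    ((integrable_mollify φ hg).sub hg).norm
  have hpt : ∀ x, ‖mollify μ φ f x - f x‖ ≤
      ‖mollify μ φ (f - g) x‖ + ‖(f - g) x‖ + ‖mollify μ φ g x - g x‖ := fun x => by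
    rw [mollify_sub φ hf.locallyIntegrable hg.locallyIntegrable]
    calc ‖mollify μ φ f x - f x‖
        = ‖(mollify μ φ f - mollify μ φ g) x - (f - g) x + (mollify μ φ g x - g x)‖ := by
          congr 1; simp only [Pi.sub_apply]; abel
      _ ≤ _ := (norm_add_le _ _).trans (by gcongr; exact norm_sub_le _ _)
  calc ∫ x in K, ‖mollify μ φ f x - f x‖ ∂μ
      ≤ ∫ x in K, (‖mollify μ φ (f - g) x‖ + ‖(f - g) x‖ + ‖mollify μ φ g x - g x‖) ∂μ :=
        integral_mono hmf.integrableOn (hsum.add hmg).integrableOn hpt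
    _ = ∫ x in K, ‖mollify μ φ (f - g) x‖ ∂μ + ∫ x in K, ‖(f - g) x‖ ∂μ
          + ∫ x in K, ‖mollify μ φ g x - g x‖ ∂μ := by
        rw [integral_add hsum.integrableOn hmg.integrableOn,
          integral_add hmfg.integrableOn hfg.norm.integrableOn]
    _ ≤ 2 * ∫ x, ‖f x - g x‖ ∂μ + ∫ x in K, ‖mollify μ φ g x - g x‖ ∂μ := by
        have hle : ∀ h : V → F, Integrable h μ → ∫ x in K, ‖h x‖ ∂μ ≤ ∫ x, ‖h x‖ ∂μ :=
          fun h hi => setIntegral_le_integral hi.norm (Eventually.of_forall fun _ => norm_nonneg _)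
        have h₁ := (hle _ (integrable_mollify φ hfg)).trans (integral_norm_mollify_le φ hfg)
        have h₂ := hle _ hfg
        simp only [Pi.sub_apply] at h₁ h₂ ⊢
        linarith

lemma eventually_setIntegral_norm_mollify_sub_lt_of_integrable [CompleteSpace F] {f : V → F}
    (hf : Integrable f μ) {K : Set V} (hK : IsCompact K) {ε : ℝ} (hε : 0 < ε) :
    ∀ᶠ φ in smallBumps V, ∫ x in K, ‖mollify μ φ f x - f x‖ ∂μ < ε := by
  obtain ⟨g, hgc, hfg, hg, hgi⟩ :=
    hf.exists_hasCompactSupport_integral_sub_le (ε := ε / 4) (by positivity)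
  have : 0 ≤ μ.real K := measureReal_nonneg
  filter_upwards [eventually_norm_mollify_sub_le_of_uniformContinuous (μ := μ)
    (hgc.uniformContinuous_of_continuous hg)
    (show 0 < ε / (4 * (μ.real K + 1)) by positivity)] with φ hφ
  have hgφ : ∫ x in K, ‖mollify μ φ g x - g x‖ ∂μ ≤ ε / 4 := by
    calc ∫ x in K, ‖mollify μ φ g x - g x‖ ∂μ ≤ ∫ _ in K, ε / (4 * (μ.real K + 1)) ∂μ :=
          integral_mono ((integrable_mollify φ hgi).sub hgi).norm.integrableOn
            (integrableOn_const hK.measure_lt_top.ne) hφ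
      _ = μ.real K / (μ.real K + 1) * (ε / 4) := by
          rw [setIntegral_const, smul_eq_mul]; field_simp
      _ ≤ ε / 4 := mul_le_of_le_one_left (by positivity) (div_le_one_of_le₀ (by linarith)
          (by positivity))
  linarith [setIntegral_norm_mollify_sub_le φ hf hgi K]

lemma eventually_setIntegral_norm_mollify_sub_lt [CompleteSpace F] {f : V → F}
    (hf : LocallyIntegrable f μ) {K : Set V} (hK : IsCompact K) {ε : ℝ} (hε : 0 < ε) :
    ∀ᶠ φ in smallBumps V, ∫ x in K, ‖mollify μ φ f x - f x‖ ∂μ < ε := by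
  set K' := Metric.cthickening 1 K
  have hK' : IsCompact K' := hK.cthickening
  have hi : Integrable (K'.indicator f) μ :=
    (hf.integrableOn_isCompact hK').integrable_indicator hK'.measurableSet
  filter_upwards [eventually_setIntegral_norm_mollify_sub_lt_of_integrable hi hK hε,
    eventually_rOut_lt one_pos] with φ hφ hφ1
  convert hφ using 1
  refine setIntegral_congr_fun hK.measurableSet fun x hx => ?_
  have heq : Set.EqOn f (K'.indicator f) (Metric.ball x φ.rOut) := fun y hy =>
    (Set.indicator_of_mem (Metric.mem_cthickening_of_dist_le y x 1 _ hx
      ((Metric.mem_ball.1 hy).trans hφ1).le) f).symm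
  simp only [mollify_eq_of_eqOn_ball heq, heq (Metric.mem_ball_self φ.rOut_pos)]

lemma fderiv_mollify_apply (φ : ContDiffBump (0 : V)) {u : V → ℝ} (hu : LocallyIntegrable u μ)
    (x e : V) : fderiv ℝ (mollify μ φ u) x e =
      -∫ y, u y * fderiv ℝ (fun y => φ.normed μ (x - y)) y e ∂μ := by
  have hρ : ContDiff ℝ 1 (φ.normed μ) := φ.contDiff_normed
  have hρc : HasCompactSupport (φ.normed μ) := φ.hasCompactSupport_normed
  have hconv := (hρc.fderiv ℝ).convolutionExists_left
    ((ContinuousLinearMap.lsmul ℝ ℝ : ℝ →L[ℝ] ℝ →L[ℝ] ℝ).precompL V)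
    (hρ.continuous_fderiv one_ne_zero) hu x
  have hd := (hρc.hasFDerivAt_convolution_left (ContinuousLinearMap.lsmul ℝ ℝ) hρ hu x).fderiv
  have hcomp : ∀ y, fderiv ℝ (fun y => φ.normed μ (x - y)) y e
      = -fderiv ℝ (φ.normed μ) (x - y) e := fun y => by
    have h := ((hρ.differentiable one_ne_zero _).hasFDerivAt.comp y
      ((hasFDerivAt_id y).const_sub x)).fderiv
    simpa [Function.comp_def] using DFunLike.congr_fun h e
  calc fderiv ℝ (mollify μ φ u) x e = ∫ t, fderiv ℝ (φ.normed μ) t e * u (x - t) ∂μ := by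
        rw [mollify, hd, convolution_def, ContinuousLinearMap.integral_apply hconv]
        simp [ContinuousLinearMap.precompL_apply]
    _ = ∫ y, fderiv ℝ (φ.normed μ) (x - y) e * u y ∂μ := by
        rw [← integral_sub_left_eq_self _ μ x]
        simp only [sub_sub_cancel]
    _ = -∫ y, u y * fderiv ℝ (fun y => φ.normed μ (x - y)) y e ∂μ := by
        simp only [hcomp, mul_neg, integral_neg, neg_neg, mul_comm]

lemma IsWeakGradient.gradient_mollify {N : ℕ} {u : E N → ℝ} {G : E N → E N}
    (h : IsWeakGradient u G) (φ : ContDiffBump (0 : E N)) :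
    gradient (mollify volume φ u) = mollify volume φ G := by
  obtain ⟨hu, hG, hw⟩ := h
  ext1 x
  refine ext_inner_right ℝ fun e => ?_
  have htest := hw (fun y => φ.normed volume (x - y))
    (φ.contDiff_normed.comp (contDiff_const.sub contDiff_id))
    (φ.hasCompactSupport_normed.comp_homeomorph (Homeomorph.subLeft x)) e
  rw [inner_gradient_left, fderiv_mollify_apply φ hu, htest, neg_neg, mollify_apply,
    ← real_inner_comm, ← integral_inner (integrable_normed_smul_comp_sub φ hG x),
    ← integral_sub_left_eq_self (fun t => inner ℝ e (_ • G (x - t))) volume x]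
  refine integral_congr_ae (Eventually.of_forall fun y => ?_)
  simp only [sub_sub_cancel, inner_smul_right, real_inner_comm]

theorem IsWeakGradient.exists_contDiff_approx {N : ℕ} {u : E N → ℝ} {G : E N → E N}
    (h : IsWeakGradient u G) {K : Set (E N)} (hK : IsCompact K) {ε : ℝ} (hε : 0 < ε) :
    ∃ v : E N → ℝ, ContDiff ℝ ∞ v ∧ ∫ x in K, ‖u x - v x‖ < ε ∧
      ∫ x in K, ‖G x - gradient v x‖ < ε := by
  obtain ⟨φ, hφu, hφG⟩ := ((eventually_setIntegral_norm_mollify_sub_lt h.1 hK hε).and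
    (eventually_setIntegral_norm_mollify_sub_lt h.2.1 hK hε)).exists
  refine ⟨mollify volume φ u, contDiff_mollify φ h.1, ?_, ?_⟩
  · simpa only [norm_sub_rev] using hφu
  · simpa only [h.gradient_mollify, norm_sub_rev] using hφG

end Mollification

section ChangeOfVariables

variable {α : Type*} [MeasurableSpace α]

/-- `J` is the Jacobian of the measurable automorphism `φ` with respect to `μ`: the change of
variables `y = φ x` reads `dμ(y) = J x dμ(x)`. -/
structure IsJacobian (μ : Measure α) (φ : α ≃ᵐ α) (J : α → ℝ≥0) : Prop where
  measurable : Measurable J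
  pos : ∀ x, 0 < J x
  map_withDensity : (μ.withDensity fun x => (J x : ℝ≥0∞)).map φ = μ

namespace IsJacobian

variable {μ : Measure α} {φ : α ≃ᵐ α} {J : α → ℝ≥0} (h : IsJacobian μ φ J)
include h

lemma map_symm : μ.map φ.symm = μ.withDensity fun x => (J x : ℝ≥0∞) := by
  conv_lhs => rw [← h.map_withDensity]
  rw [Measure.map_map φ.symm.measurable φ.measurable]
  simp

lemma integrable_iff {F : Type*} [NormedAddCommGroup F] [NormedSpace ℝ F] {f : α → F} :
    Integrable f μ ↔ Integrable (fun x => J x • f (φ x)) μ := by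
  conv_lhs => rw [← h.map_withDensity]
  rw [φ.measurableEmbedding.integrable_map_iff,
    integrable_withDensity_iff_integrable_smul h.measurable, Function.comp_def]

lemma integral_eq {F : Type*} [NormedAddCommGroup F] [NormedSpace ℝ F] (f : α → F) :
    ∫ y, f y ∂μ = ∫ x, J x • f (φ x) ∂μ := by
  conv_lhs => rw [← h.map_withDensity]
  rw [φ.measurableEmbedding.integral_map, integral_withDensity_eq_integral_smul h.measurable]

lemma quasiMeasurePreserving_symm : Measure.QuasiMeasurePreserving φ.symm μ μ :=
  ⟨φ.symm.measurable, h.map_symm ▸ withDensity_absolutelyContinuous μ _⟩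

lemma quasiMeasurePreserving : Measure.QuasiMeasurePreserving φ μ μ := by
  have hac : μ ≪ μ.withDensity fun x => (J x : ℝ≥0∞) :=
    withDensity_absolutelyContinuous' h.measurable.coe_nnreal_ennreal.aemeasurable
      (Eventually.of_forall fun x => by simpa using (h.pos x).ne')
  refine ⟨φ.measurable, ?_⟩
  conv_rhs => rw [← h.map_withDensity]
  exact hac.map φ.measurable

lemma map_symm_le {c : ℝ≥0} (hc : ∀ x, J x ≤ c) : μ.map φ.symm ≤ c • μ := by
  rw [h.map_symm]
  exact (withDensity_mono (Eventually.of_forall fun x => by exact_mod_cast hc x)).trans_eq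
    (withDensity_const _)

lemma integrableOn_comp_symm {F : Type*} [NormedAddCommGroup F] {c : ℝ≥0} (hc : ∀ x, J x ≤ c)
    {f : α → F} {K : Set α} (hf : IntegrableOn f (φ.symm '' K) μ) :
    IntegrableOn (fun y => f (φ.symm y)) K μ := by
  have hsmul : IntegrableOn f (φ.symm '' K) (c • μ) := by
    rw [IntegrableOn, Measure.restrict_smul]
    exact hf.smul_measure_nnreal
  have hmap := hsmul.mono_measure (h.map_symm_le hc)
  rw [φ.symm.measurableEmbedding.integrableOn_map_iff,
    Set.preimage_image_eq K φ.symm.injective] at hmap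
  exact hmap

lemma setIntegral_norm_comp_symm_le {F : Type*} [NormedAddCommGroup F] {c : ℝ≥0}
    (hc : ∀ x, J x ≤ c) {f : α → F} {K : Set α} (hf : IntegrableOn f (φ.symm '' K) μ) :
    ∫ y in K, ‖f (φ.symm y)‖ ∂μ ≤ c * ∫ x in φ.symm '' K, ‖f x‖ ∂μ := by
  calc ∫ y in K, ‖f (φ.symm y)‖ ∂μ = ∫ x in φ.symm '' K, ‖f x‖ ∂μ.map φ.symm := by
        rw [φ.symm.measurableEmbedding.setIntegral_map, Set.preimage_image_eq K φ.symm.injective]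
    _ ≤ ∫ x in φ.symm '' K, ‖f x‖ ∂(c • μ) :=
        integral_mono_measure (Measure.restrict_mono_measure (h.map_symm_le hc) _)
          (Eventually.of_forall fun _ => norm_nonneg _)
          (by rw [Measure.restrict_smul]; exact hf.norm.smul_measure_nnreal)
    _ = c * ∫ x in φ.symm '' K, ‖f x‖ ∂μ := by
        rw [Measure.restrict_smul, integral_smul_nnreal_measure, NNReal.smul_def, smul_eq_mul]

lemma prod [SFinite μ] : IsJacobian (μ.prod μ) (φ.prodCongr φ) (fun z => J z.1 * J z.2) where
  measurable := (h.measurable.comp measurable_fst).mul (h.measurable.comp measurable_snd)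
  pos z := mul_pos (h.pos _) (h.pos _)
  map_withDensity := by
    have hmap := Measure.map_prod_map (μ.withDensity fun x => (J x : ℝ≥0∞))
      (μ.withDensity fun x => (J x : ℝ≥0∞)) φ.measurable φ.measurable
    rw [h.map_withDensity, prod_withDensity h.measurable.coe_nnreal_ennreal
      h.measurable.coe_nnreal_ennreal] at hmap
    simp only [ENNReal.coe_mul]
    exact hmap.symm

end IsJacobian

end ChangeOfVariables

section Determinant

variable {V : Type*} [NormedAddCommGroup V] [NormedSpace ℝ V] [FiniteDimensional ℝ V]

lemma nnnorm_det_le_pow (A : V →L[ℝ] V) : ‖A.det‖₊ ≤ ‖A‖₊ ^ Module.finrank ℝ V := by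
  borelize V
  set μ : Measure V := Measure.addHaar
  have himage : A '' Metric.closedBall 0 1 ⊆ Metric.closedBall 0 ‖A‖ := by
    rintro _ ⟨v, hv, rfl⟩
    rw [mem_closedBall_zero_iff] at hv ⊢
    simpa using A.le_opNorm_of_le hv
  have hvol := measure_mono (μ := μ) himage
  rw [Measure.addHaar_image_continuousLinearMap,
    Measure.addHaar_closedBall' μ 0 (norm_nonneg A), ENNReal.mul_le_mul_iff_left
      (Metric.measure_closedBall_pos μ 0 one_pos).ne' measure_closedBall_lt_top.ne,
    ENNReal.ofReal_le_ofReal_iff (by positivity)] at hvol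
  exact hvol

lemma pow_le_nnnorm_det (A : V ≃L[ℝ] V) {c : ℝ≥0} (hc : 0 < c)
    (hA : ‖(A.symm : V →L[ℝ] V)‖₊ ≤ c⁻¹) :
    c ^ Module.finrank ℝ V ≤ ‖(A : V →L[ℝ] V).det‖₊ := by
  have h := (nnnorm_det_le_pow (A.symm : V →L[ℝ] V)).trans (pow_le_pow_left' hA _)
  rw [A.det_coe_symm, nnnorm_inv, inv_pow] at h
  refine (inv_le_inv₀ ?_ (pow_pos hc _)).1 h
  exact nnnorm_pos.2 (LinearEquiv.isUnit_det' A.toLinearEquiv).ne_zero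

end Determinant

/-- A `C¹` vector field on `ℝ^N` with Lipschitz constant `lip < 1`, seen as a perturbation of the
identity: it generates the diffeomorphism `x ↦ x - field x`, which is bi-Lipschitz with constant
`(1 - lip)⁻¹`. -/
structure Perturbation (N : ℕ) where
  field : E N → E N
  lip : ℝ≥0
  contDiff_field : ContDiff ℝ 1 field
  lipschitz_field : LipschitzWith lip field
  lip_lt_one : lip < 1

namespace Perturbation

variable {N : ℕ} (D : Perturbation N)

/-- The lower Lipschitz constant of `x ↦ x - field x`. The subtraction in `ℝ≥0` does not truncate
since `lip < 1`. -/
def ratio : ℝ≥0 := 1 - D.lip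

lemma coe_ratio : (D.ratio : ℝ) = 1 - D.lip := by
  rw [ratio, NNReal.coe_sub D.lip_lt_one.le, NNReal.coe_one]

lemma ratio_pos : 0 < D.ratio := tsub_pos_of_lt D.lip_lt_one

lemma ratio_le_one : D.ratio ≤ 1 := tsub_le_self

lemma one_add_lip_le : (1 + D.lip : ℝ) ≤ (D.ratio : ℝ)⁻¹ := by
  have hpos : (0 : ℝ) < D.ratio := D.ratio_pos
  rw [← mul_one (D.ratio : ℝ)⁻¹, le_inv_mul_iff₀ hpos, coe_ratio]
  nlinarith [sq_nonneg (D.lip : ℝ)]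

lemma approximatesLinearOn_id : ApproximatesLinearOn (fun x => x - D.field x)
    (ContinuousLinearEquiv.refl ℝ (E N) : E N →L[ℝ] E N) Set.univ D.lip := fun x _ y _ => by
  simpa [sub_sub_sub_comm, norm_sub_rev, dist_eq_norm] using D.lipschitz_field.dist_le_mul x y

/-- The homeomorphism `x ↦ x - field x` generated by the perturbation. -/
def toHomeo : E N ≃ₜ E N :=
  D.approximatesLinearOn_id.toHomeomorph _ (by
    rcases subsingleton_or_nontrivial (E N) with h | h
    · exact .inl h
    · right
      simpa using D.lip_lt_one)

lemma toHomeo_apply (x : E N) : D.toHomeo x = x - D.field x := rfl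

lemma norm_toHomeo_sub_le (x y : E N) :
    ‖D.toHomeo x - D.toHomeo y‖ ≤ (D.ratio : ℝ)⁻¹ * ‖x - y‖ := by
  calc ‖D.toHomeo x - D.toHomeo y‖ = ‖(x - y) - (D.field x - D.field y)‖ := by
        rw [toHomeo_apply, toHomeo_apply, sub_sub_sub_comm]
    _ ≤ ‖x - y‖ + D.lip * ‖x - y‖ :=
        (norm_sub_le _ _).trans (by gcongr; exact D.lipschitz_field.norm_sub_le x y)
    _ = (1 + D.lip) * ‖x - y‖ := by ring
    _ ≤ (D.ratio : ℝ)⁻¹ * ‖x - y‖ := by gcongr; exact D.one_add_lip_le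

lemma le_norm_toHomeo_sub (x y : E N) : D.ratio * ‖x - y‖ ≤ ‖D.toHomeo x - D.toHomeo y‖ := by
  calc D.ratio * ‖x - y‖ = ‖x - y‖ - D.lip * ‖x - y‖ := by rw [coe_ratio]; ring
    _ ≤ ‖x - y‖ - ‖D.field x - D.field y‖ := by gcongr; exact D.lipschitz_field.norm_sub_le x y
    _ ≤ ‖(x - y) - (D.field x - D.field y)‖ := norm_sub_norm_le _ _
    _ = ‖D.toHomeo x - D.toHomeo y‖ := by rw [toHomeo_apply, toHomeo_apply, sub_sub_sub_comm]

lemma norm_symm_sub_le (x y : E N) :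
    ‖D.toHomeo.symm x - D.toHomeo.symm y‖ ≤ (D.ratio : ℝ)⁻¹ * ‖x - y‖ := by
  rw [le_inv_mul_iff₀ (by exact_mod_cast D.ratio_pos)]
  simpa using D.le_norm_toHomeo_sub (D.toHomeo.symm x) (D.toHomeo.symm y)

lemma contDiff_toHomeo : ContDiff ℝ 1 D.toHomeo := contDiff_id.sub D.contDiff_field

lemma fderiv_toHomeo (x : E N) : fderiv ℝ D.toHomeo x = 1 - fderiv ℝ D.field x :=
  ((hasFDerivAt_id x).sub
    (D.contDiff_field.differentiable one_ne_zero x).hasFDerivAt).fderiv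

/-- The derivative of `x ↦ x - field x`, as a continuous linear equivalence. -/
def fderivEquiv (x : E N) : E N ≃L[ℝ] E N :=
  ContinuousLinearEquiv.unitsEquiv ℝ (E N) (Units.oneSub (fderiv ℝ D.field x)
    ((norm_fderiv_le_of_lipschitz ℝ D.lipschitz_field).trans_lt (by exact_mod_cast D.lip_lt_one)))

lemma coe_fderivEquiv (x : E N) : (D.fderivEquiv x : E N →L[ℝ] E N) = fderiv ℝ D.toHomeo x := by
  rw [fderiv_toHomeo]; rfl

lemma hasFDerivAt_toHomeo (x : E N) :
    HasFDerivAt D.toHomeo (D.fderivEquiv x : E N →L[ℝ] E N) x := by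
  rw [coe_fderivEquiv]
  exact (D.contDiff_toHomeo.differentiable one_ne_zero x).hasFDerivAt

lemma contDiff_symm : ContDiff ℝ 1 D.toHomeo.symm :=
  D.toHomeo.contDiff_symm D.hasFDerivAt_toHomeo D.contDiff_toHomeo

lemma fderiv_symm_toHomeo (x : E N) :
    fderiv ℝ D.toHomeo.symm (D.toHomeo x) = (D.fderivEquiv x).symm := by
  refine HasFDerivAt.fderiv (HasFDerivAt.of_local_left_inverse
    D.toHomeo.symm.continuous.continuousAt ?_ (Eventually.of_forall D.toHomeo.apply_symm_apply))
  rw [D.toHomeo.symm_apply_apply]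
  exact D.hasFDerivAt_toHomeo x

lemma nnnorm_fderiv_toHomeo_le (x : E N) : ‖fderiv ℝ D.toHomeo x‖₊ ≤ D.ratio⁻¹ :=
  norm_fderiv_le_of_lipschitz ℝ (C := D.ratio⁻¹) <| LipschitzWith.of_dist_le_mul fun x y => by
    simpa [dist_eq_norm] using D.norm_toHomeo_sub_le x y

lemma nnnorm_fderiv_symm_le (y : E N) : ‖fderiv ℝ D.toHomeo.symm y‖₊ ≤ D.ratio⁻¹ :=
  norm_fderiv_le_of_lipschitz ℝ (C := D.ratio⁻¹) <| LipschitzWith.of_dist_le_mul fun x y => by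
    simpa [dist_eq_norm] using D.norm_symm_sub_le x y

/-- The absolute value of the Jacobian determinant of `x ↦ x - field x`. -/
def jac (x : E N) : ℝ≥0 := ‖(fderiv ℝ D.toHomeo x).det‖₊

lemma jac_le (x : E N) : D.jac x ≤ D.ratio⁻¹ ^ N := by
  have h := nnnorm_det_le_pow (fderiv ℝ D.toHomeo x)
  rw [finrank_euclideanSpace_fin] at h
  exact h.trans (by gcongr; exact D.nnnorm_fderiv_toHomeo_le x)

lemma ratio_pow_le_jac (x : E N) : D.ratio ^ N ≤ D.jac x := by
  have h := pow_le_nnnorm_det (D.fderivEquiv x) D.ratio_pos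
    (D.fderiv_symm_toHomeo x ▸ D.nnnorm_fderiv_symm_le (D.toHomeo x))
  rwa [finrank_euclideanSpace_fin, coe_fderivEquiv] at h

lemma continuous_jac : Continuous D.jac :=
  (ContinuousLinearMap.continuous_det.comp
    (D.contDiff_toHomeo.continuous_fderiv one_ne_zero)).nnnorm

lemma isJacobian : IsJacobian volume D.toHomeo.toMeasurableEquiv D.jac where
  measurable := D.continuous_jac.measurable
  pos x := (pow_pos D.ratio_pos N).trans_le (D.ratio_pow_le_jac x)
  map_withDensity := by
    have hmap := map_withDensity_abs_det_fderiv_eq_addHaar (volume : Measure (E N))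
      (s := Set.univ) nullMeasurableSet_univ
      (fun x _ => (D.hasFDerivAt_toHomeo x).hasFDerivWithinAt) D.toHomeo.injective.injOn
    simp only [Set.image_univ, D.toHomeo.surjective.range_eq, Measure.restrict_univ,
      coe_fderivEquiv, ← Real.enorm_eq_ofReal_abs] at hmap
    exact hmap

lemma integrableOn_comp_symm {F : Type*} [NormedAddCommGroup F] {f : E N → F} {K : Set (E N)}
    (hf : IntegrableOn f (D.toHomeo.symm '' K) volume) :
    IntegrableOn (fun y => f (D.toHomeo.symm y)) K volume :=
  D.isJacobian.integrableOn_comp_symm D.jac_le hf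

lemma setIntegral_norm_comp_symm_le {F : Type*} [NormedAddCommGroup F] {f : E N → F}
    {K : Set (E N)} (hf : IntegrableOn f (D.toHomeo.symm '' K) volume) :
    ∫ y in K, ‖f (D.toHomeo.symm y)‖ ≤
      (D.ratio : ℝ)⁻¹ ^ N * ∫ x in D.toHomeo.symm '' K, ‖f x‖ := by
  simpa using D.isJacobian.setIntegral_norm_comp_symm_le D.jac_le hf

lemma locallyIntegrable_comp_symm {F : Type*} [NormedAddCommGroup F] {f : E N → F}
    (hf : LocallyIntegrable f volume) :
    LocallyIntegrable (fun y => f (D.toHomeo.symm y)) volume :=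
  locallyIntegrable_iff.2 fun _ hK =>
    D.integrableOn_comp_symm (hf.integrableOn_isCompact (hK.image D.toHomeo.symm.continuous))

end Perturbation

section DilationField

variable {N : ℕ}

/-- A radial cutoff profile: `1` on `[0, 1]` and `0` on `[√2, ∞)`. It is a smooth function of `r²`,
so that `x ↦ cutoff ‖x‖` is smooth at the origin. -/
def cutoff (r : ℝ) : ℝ := Real.smoothTransition (2 - r ^ 2)

lemma cutoff_nonneg (r : ℝ) : 0 ≤ cutoff r := Real.smoothTransition.nonneg _

lemma cutoff_le_one (r : ℝ) : cutoff r ≤ 1 := Real.smoothTransition.le_one _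

lemma cutoff_of_le_one {r : ℝ} (h₀ : 0 ≤ r) (h : r ≤ 1) : cutoff r = 1 :=
  Real.smoothTransition.one_of_one_le (by nlinarith)

lemma cutoff_of_two_le {r : ℝ} (h : 2 ≤ r) : cutoff r = 0 :=
  Real.smoothTransition.zero_of_nonpos (by nlinarith)

/-- The vector field `x ↦ x`, truncated to a compact set. -/
def truncId (x : E N) : E N := cutoff ‖x‖ • x

lemma contDiff_truncId : ContDiff ℝ ∞ (truncId : E N → E N) :=
  (Real.smoothTransition.contDiff.comp (contDiff_const.sub (contDiff_norm_sq ℝ))).smul contDiff_id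

lemma hasCompactSupport_truncId : HasCompactSupport (truncId : E N → E N) := by
  refine HasCompactSupport.intro (isCompact_closedBall (0 : E N) 2) fun x hx => ?_
  rw [mem_closedBall_zero_iff, not_le] at hx
  simp [truncId, cutoff_of_two_le hx.le]

lemma exists_lipschitzWith_truncId (N : ℕ) : ∃ C : ℝ≥0, LipschitzWith C (truncId : E N → E N) :=
  contDiff_truncId.lipschitzWith_of_hasCompactSupport hasCompactSupport_truncId (by simp)

/-- The dilation field `x ↦ x`, truncated near the origin and near infinity: it is the identity on
`core N R` and vanishes off `annulus N R`. Both truncations are rescalings of `truncId`, so that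
the Lipschitz constant does not depend on `R`. -/
def dilField (R : ℝ) (x : E N) : E N := R • truncId (R⁻¹ • x) - R⁻¹ • truncId (R • x)

/-- The factor `ρ` for which `dilField R x = ρ ‖x‖ • x`. -/
def dilProfile (R r : ℝ) : ℝ := cutoff (R⁻¹ * r) - cutoff (R * r)

lemma dilProfile_le_one (R r : ℝ) : dilProfile R r ≤ 1 := by
  unfold dilProfile
  linarith [cutoff_le_one (R⁻¹ * r), cutoff_nonneg (R * r)]

lemma dilField_eq_smul {R : ℝ} (hR : 0 < R) (x : E N) :
    dilField R x = dilProfile R ‖x‖ • x := by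
  simp only [dilField, truncId, dilProfile, norm_smul, norm_inv, Real.norm_of_nonneg hR.le,
    smul_smul, sub_smul]
  congr 2 <;> field_simp

lemma contDiff_dilField (R : ℝ) : ContDiff ℝ ∞ (dilField R : E N → E N) :=
  ((contDiff_truncId.comp (contDiff_id.const_smul _)).const_smul _).sub
    ((contDiff_truncId.comp (contDiff_id.const_smul _)).const_smul _)

lemma lipschitzWith_smul_comp_inv_smul {V : Type*} [NormedAddCommGroup V] [NormedSpace ℝ V]
    {C : ℝ≥0} {f : V → V} (hf : LipschitzWith C f) {r : ℝ} (hr : r ≠ 0) :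
    LipschitzWith C fun x => r • f (r⁻¹ • x) := by
  refine ((lipschitzWith_smul r).comp (hf.comp (lipschitzWith_smul r⁻¹))).weaken (le_of_eq ?_)
  rw [nnnorm_inv, mul_left_comm, mul_inv_cancel₀ (nnnorm_ne_zero_iff.2 hr), mul_one]

/-- A Lipschitz constant common to all the fields `dilField R`. -/
def dilLip (N : ℕ) : ℝ≥0 :=
  (exists_lipschitzWith_truncId N).choose + (exists_lipschitzWith_truncId N).choose

lemma lipschitzWith_dilField {R : ℝ} (hR : 0 < R) :
    LipschitzWith (dilLip N) (dilField R : E N → E N) := by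
  have hC := (exists_lipschitzWith_truncId N).choose_spec
  refine (lipschitzWith_smul_comp_inv_smul hC hR.ne').sub ?_
  simpa using lipschitzWith_smul_comp_inv_smul hC (inv_pos.2 hR).ne'

/-- The annulus outside of which `dilField R` vanishes. -/
def annulus (N : ℕ) (R : ℝ) : Set (E N) := {x | R⁻¹ ≤ ‖x‖ ∧ ‖x‖ ≤ 2 * R}

lemma isCompact_annulus (R : ℝ) : IsCompact (annulus N R) :=
  (isCompact_closedBall (0 : E N) (2 * R)).of_isClosed_subset
    ((isClosed_le continuous_const continuous_norm).inter
      (isClosed_le continuous_norm continuous_const))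
    fun x hx => by simpa using hx.2

lemma dilField_of_notMem_annulus {R : ℝ} (hR : 1 ≤ R) {x : E N} (hx : x ∉ annulus N R) :
    dilField R x = 0 := by
  have hR₀ : 0 < R := one_pos.trans_le hR
  have hprofile : dilProfile R ‖x‖ = 0 := by
    rcases lt_or_ge ‖x‖ R⁻¹ with hsmall | hlarge
    · have h₁ : R * ‖x‖ ≤ 1 := (le_inv_mul_iff₀ hR₀).1 (by simpa using hsmall.le)
      have h₂ : R⁻¹ * ‖x‖ ≤ 1 := (mul_le_mul_of_nonneg_right ((inv_le_one_of_one_le₀ hR).trans hR)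
        (norm_nonneg x)).trans h₁
      rw [dilProfile, cutoff_of_le_one (by positivity) h₂, cutoff_of_le_one (by positivity) h₁,
        sub_self]
    · have hlt : 2 * R < ‖x‖ := not_le.1 fun hle => hx ⟨hlarge, hle⟩
      have h₁ : 2 ≤ R⁻¹ * ‖x‖ := (le_inv_mul_iff₀ hR₀).2 (by linarith)
      have h₂ : 2 ≤ R * ‖x‖ := h₁.trans (mul_le_mul_of_nonneg_right
        ((inv_le_one_of_one_le₀ hR).trans hR) (norm_nonneg x))
      rw [dilProfile, cutoff_of_two_le h₁, cutoff_of_two_le h₂, sub_self]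
  rw [dilField_eq_smul hR₀, hprofile, zero_smul]

/-- The open annulus on which `dilField R` is the identity. -/
def core (N : ℕ) (R : ℝ) : Set (E N) := {x | 2 * R⁻¹ < ‖x‖ ∧ ‖x‖ < R}

lemma isOpen_core (R : ℝ) : IsOpen (core N R) :=
  (isOpen_lt continuous_const continuous_norm).inter (isOpen_lt continuous_norm continuous_const)

lemma dilField_of_mem_core {R : ℝ} (hR : 0 < R) {x : E N} (hx : x ∈ core N R) :
    dilField R x = x := by
  have h₁ : R⁻¹ * ‖x‖ ≤ 1 := (inv_mul_le_iff₀ hR).2 (by linarith [hx.2])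
  have h₂ : 2 ≤ R * ‖x‖ := by
    have h := mul_le_mul_of_nonneg_left hx.1.le hR.le
    rwa [mul_left_comm, mul_inv_cancel₀ hR.ne', mul_one] at h
  rw [dilField_eq_smul hR, dilProfile, cutoff_of_le_one (by positivity) h₁, cutoff_of_two_le h₂,
    sub_zero, one_smul]

lemma eventually_mem_core {x : E N} (hx : x ≠ 0) : ∀ᶠ R in atTop, x ∈ core N R := by
  have hinv : Tendsto (fun R : ℝ => 2 * R⁻¹) atTop (𝓝 0) := by
    simpa using tendsto_inv_atTop_zero.const_mul (2 : ℝ)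
  exact (hinv.eventually_lt_const (norm_pos_iff.2 hx)).and (eventually_gt_atTop _)

end DilationField

/-- The parameters of an inner variation: a scale `R` and a step size `t` so small that
`x ↦ x - t • dilField R x` is a diffeomorphism. -/
structure Step (N : ℕ) where
  R : ℝ
  t : ℝ
  one_le_R : 1 ≤ R
  t_pos : 0 < t
  t_le_half : t ≤ 1 / 2
  t_mul_dilLip_le : t * dilLip N ≤ 1 / 2

namespace Step

variable {N : ℕ} (z : Step N)

lemma R_pos : 0 < z.R := one_pos.trans_le z.one_le_R

lemma one_sub_t_pos : 0 < 1 - z.t := by linarith [z.t_le_half]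

/-- The perturbation `t • dilField R` of the identity. -/
def deform : Perturbation N where
  field x := z.t • dilField z.R x
  lip := ‖z.t‖₊ * dilLip N
  contDiff_field := ((contDiff_dilField z.R).of_le (by simp)).const_smul z.t
  lipschitz_field := (lipschitzWith_smul z.t).comp (lipschitzWith_dilField z.R_pos)
  lip_lt_one := by
    rw [← NNReal.coe_lt_coe, NNReal.coe_mul, coe_nnnorm, Real.norm_of_nonneg z.t_pos.le]
    exact z.t_mul_dilLip_le.trans_lt (by norm_num)

lemma ratio_deform : (z.deform.ratio : ℝ) = 1 - z.t * dilLip N := by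
  rw [Perturbation.coe_ratio]
  simp [deform, abs_of_pos z.t_pos]

lemma half_le_ratio_deform : (1 / 2 : ℝ) ≤ z.deform.ratio := by
  linarith [z.ratio_deform, z.t_mul_dilLip_le]

lemma inv_ratio_deform_le : (z.deform.ratio : ℝ)⁻¹ ≤ 2 := by
  simpa using inv_anti₀ (by norm_num) z.half_le_ratio_deform

lemma deform_apply (x : E N) : z.deform.toHomeo x = x - z.t • dilField z.R x := rfl

lemma deform_eq_smul (x : E N) :
    z.deform.toHomeo x = (1 - z.t * dilProfile z.R ‖x‖) • x := by
  rw [deform_apply, dilField_eq_smul z.R_pos, sub_smul, one_smul, smul_smul]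

lemma deform_zero : z.deform.toHomeo 0 = 0 := by rw [deform_eq_smul, smul_zero]

lemma norm_deform (x : E N) :
    ‖z.deform.toHomeo x‖ = (1 - z.t * dilProfile z.R ‖x‖) * ‖x‖ := by
  have hfactor : 0 ≤ 1 - z.t * dilProfile z.R ‖x‖ := by
    nlinarith [dilProfile_le_one z.R ‖x‖, z.t_pos, z.t_le_half]
  rw [deform_eq_smul, norm_smul, Real.norm_of_nonneg hfactor]

lemma norm_eq_of_norm_deform_eq {x y : E N} (h : ‖z.deform.toHomeo x‖ = ‖z.deform.toHomeo y‖) :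
    ‖x‖ = ‖y‖ := by
  rcases eq_or_ne x 0 with rfl | hx
  · rw [deform_zero, norm_zero, eq_comm, norm_eq_zero, ← z.deform_zero] at h
    rw [z.deform.toHomeo.injective h]
  · have hx₀ : ‖x‖ ≠ 0 := norm_ne_zero_iff.2 hx
    -- the point of the ray through `x` on the sphere of `y` has the same image as `x`
    set w : E N := (‖y‖ / ‖x‖) • x with hw
    have hw_norm : ‖w‖ = ‖y‖ := by
      rw [hw, norm_smul, Real.norm_of_nonneg (by positivity), div_mul_cancel₀ _ hx₀]
    have himage : z.deform.toHomeo w = z.deform.toHomeo x := by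
      rw [norm_deform, norm_deform] at h
      rw [deform_eq_smul, deform_eq_smul, hw_norm, hw, smul_smul, ← mul_div_assoc, ← h,
        mul_div_cancel_right₀ _ hx₀]
    rw [← z.deform.toHomeo.injective himage, hw_norm]

lemma norm_deform_symm_eq {x y : E N} (h : ‖x‖ = ‖y‖) :
    ‖z.deform.toHomeo.symm x‖ = ‖z.deform.toHomeo.symm y‖ :=
  z.norm_eq_of_norm_deform_eq (by simpa using h)

lemma deform_of_mem_core {x : E N} (hx : x ∈ core N z.R) :
    z.deform.toHomeo x = (1 - z.t) • x := by
  rw [deform_apply, dilField_of_mem_core z.R_pos hx, sub_smul, one_smul]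

lemma fderiv_deform_of_mem_core {x : E N} (hx : x ∈ core N z.R) :
    fderiv ℝ z.deform.toHomeo x = (1 - z.t) • ContinuousLinearMap.id ℝ (E N) := by
  have heq : z.deform.toHomeo =ᶠ[𝓝 x] fun y => (1 - z.t) • y := by
    filter_upwards [(isOpen_core z.R).mem_nhds hx] with y hy using z.deform_of_mem_core hy
  rw [heq.fderiv_eq]
  exact ((hasFDerivAt_id x).const_smul (1 - z.t)).fderiv

lemma jac_deform_of_mem_core {x : E N} (hx : x ∈ core N z.R) :
    (z.deform.jac x : ℝ) = (1 - z.t) ^ N := by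
  rw [Perturbation.jac, coe_nnnorm, z.fderiv_deform_of_mem_core hx, ContinuousLinearMap.det,
    ContinuousLinearMap.toLinearMap_smul, LinearMap.det_smul]
  simp [abs_of_pos z.one_sub_t_pos]

lemma deform_of_notMem_annulus {x : E N} (hx : x ∉ annulus N z.R) : z.deform.toHomeo x = x := by
  rw [deform_apply, dilField_of_notMem_annulus z.one_le_R hx, smul_zero, sub_zero]

lemma deform_symm_of_notMem_annulus {x : E N} (hx : x ∉ annulus N z.R) :
    z.deform.toHomeo.symm x = x := by
  rw [Homeomorph.symm_apply_eq, z.deform_of_notMem_annulus hx]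

lemma deform_mem_annulus_iff {x : E N} :
    z.deform.toHomeo x ∈ annulus N z.R ↔ x ∈ annulus N z.R := by
  refine not_iff_not.1 ⟨fun hx => ?_, fun hx => by rwa [z.deform_of_notMem_annulus hx]⟩
  rwa [← z.deform.toHomeo.symm_apply_apply x, z.deform_symm_of_notMem_annulus hx]

lemma deform_symm_image_annulus : z.deform.toHomeo.symm '' annulus N z.R = annulus N z.R := by
  ext x
  rw [← Homeomorph.preimage_symm]
  exact z.deform_mem_annulus_iff

end Step

/-- The regime of small inner variations: the step size tends to `0` first, and then the scale
tends to infinity. -/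
def smallSteps (N : ℕ) : Filter (Step N) :=
  comap (fun z => (z.R, z.t)) (atTop.curry (𝓝[>] 0))

section SmallSteps

variable {N : ℕ}

lemma eventually_smallSteps_iff {P : Step N → Prop} :
    (∀ᶠ z in smallSteps N, P z) ↔
      ∀ᶠ R in atTop, ∀ᶠ t in 𝓝[>] 0, ∀ z : Step N, z.R = R → z.t = t → P z := by
  simp only [smallSteps, eventually_comap, eventually_curry_iff, Prod.mk.injEq, and_imp]

lemma tendsto_t_smallSteps : Tendsto Step.t (smallSteps N) (𝓝[>] 0) := fun s hs =>
  eventually_smallSteps_iff.2 <| Eventually.of_forall fun _ => by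
    filter_upwards [hs] with t ht z _ hz
    rwa [hz]

lemma tendsto_R_smallSteps : Tendsto Step.R (smallSteps N) atTop := fun s hs =>
  eventually_smallSteps_iff.2 <| by
    filter_upwards [hs] with R hR
    exact Eventually.of_forall fun t z hz _ => by rwa [hz]

lemma eventually_exists_step {R : ℝ} (hR : 1 ≤ R) :
    ∀ᶠ t in 𝓝[>] 0, ∃ z : Step N, z.R = R ∧ z.t = t := by
  have hlip : Tendsto (fun t : ℝ => t * dilLip N) (𝓝 0) (𝓝 0) := by
    have hc : Continuous fun t : ℝ => t * (dilLip N : ℝ) := by fun_prop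
    simpa using hc.tendsto 0
  filter_upwards [self_mem_nhdsWithin,
    nhdsWithin_le_nhds (eventually_lt_nhds (one_half_pos (α := ℝ))),
    nhdsWithin_le_nhds (hlip.eventually_lt_const (one_half_pos (α := ℝ)))] with t h₁ h₂ h₃
  exact ⟨⟨R, t, hR, h₁, h₂.le, h₃.le⟩, rfl, rfl⟩

instance smallSteps_neBot : (smallSteps N).NeBot := by
  rw [neBot_iff, ne_eq, ← eventually_false_iff_eq_bot, eventually_smallSteps_iff]
  intro h
  obtain ⟨R, hfalse, hR⟩ := (h.and (eventually_ge_atTop 1)).exists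
  obtain ⟨t, hno, z, hz⟩ := (hfalse.and (eventually_exists_step (N := N) hR)).exists
  exact hno z hz.1 hz.2

end SmallSteps

section WeakGradient

variable {N : ℕ}

lemma HasWeakGradient.isWeakGradient {u : E N → ℝ} (h : HasWeakGradient u) :
    IsWeakGradient u (weakGrad u) := by
  rw [weakGrad, dif_pos h]
  exact h.choose_spec

lemma continuous_gradient {v : E N → ℝ} (hv : ContDiff ℝ 1 v) : Continuous (gradient v) :=
  (InnerProductSpace.toDual ℝ (E N)).symm.continuous.comp (hv.continuous_fderiv one_ne_zero)

lemma isWeakGradient_gradient {v : E N → ℝ} (hv : ContDiff ℝ 1 v) :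
    IsWeakGradient v (gradient v) := by
  refine ⟨hv.continuous.locallyIntegrable, (continuous_gradient hv).locallyIntegrable,
    fun φ hφ hφc e => ?_⟩
  have hφd : Continuous fun x => fderiv ℝ φ x e :=
    (hφ.continuous_fderiv (by simp)).clm_apply continuous_const
  have hvd : Continuous fun x => fderiv ℝ v x e :=
    (hv.continuous_fderiv one_ne_zero).clm_apply continuous_const
  rw [integral_mul_fderiv_eq_neg_fderiv_mul_of_integrable
    ((hvd.mul hφ.continuous).integrable_of_hasCompactSupport hφc.mul_left)
    ((hv.continuous.mul hφd).integrable_of_hasCompactSupport (hφc.fderiv_apply ℝ e).mul_left)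
    ((hv.continuous.mul hφ.continuous).integrable_of_hasCompactSupport hφc.mul_left)
    (fun x _ => hv.differentiable one_ne_zero x) (fun x _ => hφ.differentiable (by simp) x)]
  simp only [inner_gradient_left, mul_comm]

/-- The distribution `⟨G - ∇u, φ e⟩`, which vanishes on all test functions exactly when `G` is
the weak gradient of `u`. -/
def gradDefect (u : E N → ℝ) (G : E N → E N) (φ : E N → ℝ) (e : E N) : ℝ :=
  ∫ x, (u x * fderiv ℝ φ x e + φ x * inner ℝ (G x) e)

section GradDefect

variable {u v φ : E N → ℝ} {G H : E N → E N}

lemma integrable_mul_fderiv (hu : LocallyIntegrable u volume) (hφ : ContDiff ℝ ∞ φ)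
    (hc : HasCompactSupport φ) (e : E N) : Integrable (fun x => u x * fderiv ℝ φ x e) volume := by
  simpa only [smul_eq_mul, mul_comm] using hu.integrable_smul_left_of_hasCompactSupport
    ((hφ.continuous_fderiv (by simp)).clm_apply continuous_const) (hc.fderiv_apply ℝ e)

lemma integrable_mul_inner (hG : LocallyIntegrable G volume) (hφ : ContDiff ℝ ∞ φ)
    (hc : HasCompactSupport φ) (e : E N) : Integrable (fun x => φ x * inner ℝ (G x) e) volume := by
  simpa only [real_inner_smul_left] using
    (hG.integrable_smul_left_of_hasCompactSupport hφ.continuous hc).inner_const (𝕜 := ℝ) e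

lemma IsWeakGradient.gradDefect_eq_zero (h : IsWeakGradient u G) (hφ : ContDiff ℝ ∞ φ)
    (hc : HasCompactSupport φ) (e : E N) : gradDefect u G φ e = 0 := by
  rw [gradDefect, integral_add (integrable_mul_fderiv h.1 hφ hc e)
    (integrable_mul_inner h.2.1 hφ hc e), h.2.2 φ hφ hc e, neg_add_cancel]

lemma isWeakGradient_of_gradDefect_eq_zero (hu : LocallyIntegrable u volume)
    (hG : LocallyIntegrable G volume)
    (h : ∀ φ, ContDiff ℝ ∞ φ → HasCompactSupport φ → ∀ e, gradDefect u G φ e = 0) :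
    IsWeakGradient u G := by
  refine ⟨hu, hG, fun φ hφ hc e => eq_neg_of_add_eq_zero_left ?_⟩
  rw [← h φ hφ hc e, gradDefect,
    integral_add (integrable_mul_fderiv hu hφ hc e) (integrable_mul_inner hG hφ hc e)]

lemma gradDefect_sub (hu : LocallyIntegrable u volume) (hv : LocallyIntegrable v volume)
    (hG : LocallyIntegrable G volume) (hH : LocallyIntegrable H volume) (hφ : ContDiff ℝ ∞ φ)
    (hc : HasCompactSupport φ) (e : E N) :
    gradDefect (fun x => u x - v x) (fun x => G x - H x) φ e =
      gradDefect u G φ e - gradDefect v H φ e := by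
  refine Eq.trans (integral_congr_ae (Eventually.of_forall fun x => ?_)) (integral_sub
    ((integrable_mul_fderiv hu hφ hc e).add (integrable_mul_inner hG hφ hc e))
    ((integrable_mul_fderiv hv hφ hc e).add (integrable_mul_inner hH hφ hc e)))
  simp only [inner_sub_left]
  ring

lemma exists_abs_gradDefect_le (hφ : ContDiff ℝ ∞ φ) (hc : HasCompactSupport φ) (e : E N) :
    ∃ C, 0 ≤ C ∧ ∀ u G, LocallyIntegrable u volume → LocallyIntegrable G volume →
      |gradDefect u G φ e| ≤ C * ((∫ x in tsupport φ, ‖u x‖) + ∫ x in tsupport φ, ‖G x‖) := by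
  obtain ⟨C₁, hC₁⟩ := (hc.fderiv_apply ℝ e).exists_bound_of_continuous
    ((hφ.continuous_fderiv (by simp)).clm_apply continuous_const)
  obtain ⟨C₂, hC₂⟩ := hc.exists_bound_of_continuous hφ.continuous
  have hC₁0 : 0 ≤ C₁ := (norm_nonneg _).trans (hC₁ 0)
  have hC₂0 : 0 ≤ C₂ := (norm_nonneg _).trans (hC₂ 0)
  refine ⟨C₁ + C₂ * ‖e‖, by positivity, fun u G hu hG => ?_⟩
  have hpt : ∀ x, ‖u x * fderiv ℝ φ x e + φ x * inner ℝ (G x) e‖ ≤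
      (C₁ + C₂ * ‖e‖) * (‖u x‖ + ‖G x‖) := fun x => by
    calc ‖u x * fderiv ℝ φ x e + φ x * inner ℝ (G x) e‖
        ≤ ‖u x‖ * ‖fderiv ℝ φ x e‖ + ‖φ x‖ * (‖G x‖ * ‖e‖) :=
          (norm_add_le _ _).trans (by
            rw [norm_mul, norm_mul]; gcongr; exact norm_inner_le_norm _ _)
      _ ≤ ‖u x‖ * C₁ + C₂ * (‖G x‖ * ‖e‖) := by gcongr; exacts [hC₁ x, hC₂ x]
      _ ≤ (C₁ + C₂ * ‖e‖) * (‖u x‖ + ‖G x‖) := by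
          nlinarith [mul_nonneg hC₁0 (norm_nonneg (G x)),
            mul_nonneg (mul_nonneg hC₂0 (norm_nonneg e)) (norm_nonneg (u x))]
  have hui := (hu.integrableOn_isCompact hc.isCompact).norm
  have hGi := (hG.integrableOn_isCompact hc.isCompact).norm
  have hK : gradDefect u G φ e =
      ∫ x in tsupport φ, (u x * fderiv ℝ φ x e + φ x * inner ℝ (G x) e) :=
    (setIntegral_eq_integral_of_forall_compl_eq_zero fun x hx => by
      simp [fderiv_of_notMem_tsupport ℝ hx, image_eq_zero_of_notMem_tsupport hx]).symm
  rw [hK, ← integral_add hui hGi, ← integral_const_mul]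
  exact norm_integral_le_of_norm_le ((hui.add hGi).const_mul _) (Eventually.of_forall hpt)

end GradDefect

lemma IsWeakGradient.sub {u v : E N → ℝ} {G H : E N → E N} (hu : IsWeakGradient u G)
    (hv : IsWeakGradient v H) : IsWeakGradient (fun x => u x - v x) (fun x => G x - H x) :=
  isWeakGradient_of_gradDefect_eq_zero (hu.1.sub hv.1) (hu.2.1.sub hv.2.1) fun φ hφ hc e => by
    rw [gradDefect_sub hu.1 hv.1 hu.2.1 hv.2.1 hφ hc, hu.gradDefect_eq_zero hφ hc,
      hv.gradDefect_eq_zero hφ hc, sub_zero]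

lemma IsWeakGradient.ae_eq {u : E N → ℝ} {G H : E N → E N} (hG : IsWeakGradient u G)
    (hH : IsWeakGradient u H) : G =ᵐ[volume] H := by
  have hsub := hG.sub hH
  have hzero := ae_eq_zero_of_integral_contDiff_smul_eq_zero hsub.2.1 fun φ hφ hc => by
    refine ext_inner_left ℝ fun e => ?_
    rw [← integral_inner (hsub.2.1.integrable_smul_left_of_hasCompactSupport hφ.continuous hc)]
    simpa [inner_smul_right, real_inner_comm] using hsub.2.2 φ hφ hc e
  filter_upwards [hzero] with x hx
  exact sub_eq_zero.1 hx

lemma isWeakGradient_of_approx {u : E N → ℝ} {G : E N → E N} (hu : LocallyIntegrable u volume)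
    (hG : LocallyIntegrable G volume)
    (h : ∀ K : Set (E N), IsCompact K → ∀ ε > 0, ∃ v H, IsWeakGradient v H ∧
      (∫ x in K, ‖u x - v x‖) + ∫ x in K, ‖G x - H x‖ ≤ ε) : IsWeakGradient u G := by
  refine isWeakGradient_of_gradDefect_eq_zero hu hG fun φ hφ hc e => ?_
  obtain ⟨C, hC, hbound⟩ := exists_abs_gradDefect_le hφ hc e
  refine abs_nonpos_iff.1 (le_of_forall_pos_le_add fun δ hδ => ?_)
  obtain ⟨ε, hε, hCε⟩ := exists_pos_mul_lt hδ C
  obtain ⟨v, H, hv, happrox⟩ := h _ hc.isCompact ε hε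
  have hsub := gradDefect_sub hu hv.1 hG hv.2.1 hφ hc e
  rw [hv.gradDefect_eq_zero hφ hc, sub_zero] at hsub
  calc |gradDefect u G φ e|
      ≤ C * ((∫ x in tsupport φ, ‖u x - v x‖) + ∫ x in tsupport φ, ‖G x - H x‖) :=
        hsub ▸ hbound _ _ (hu.sub hv.1) (hG.sub hv.2.1)
    _ ≤ C * ε := by gcongr
    _ ≤ 0 + δ := by linarith

namespace Perturbation

variable (D : Perturbation N)

/-- The gradient `(Dψ)ᵀ (G ∘ ψ)` of the transported function `u ∘ ψ`, where `G` is the gradient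
of `u` and `ψ` the inverse of the perturbed identity. -/
def pullGrad (G : E N → E N) (y : E N) : E N :=
  ContinuousLinearMap.adjoint (fderiv ℝ D.toHomeo.symm y) (G (D.toHomeo.symm y))

lemma norm_pullGrad_le (G : E N → E N) (y : E N) :
    ‖D.pullGrad G y‖ ≤ (D.ratio : ℝ)⁻¹ * ‖G (D.toHomeo.symm y)‖ := by
  refine ContinuousLinearMap.le_of_opNorm_le _ ?_ _
  rw [LinearIsometryEquiv.norm_map]
  exact D.nnnorm_fderiv_symm_le y

lemma adjoint_pullGrad (G : E N → E N) (x : E N) :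
    ContinuousLinearMap.adjoint (fderiv ℝ D.toHomeo x) (D.pullGrad G (D.toHomeo x)) = G x := by
  rw [pullGrad, D.fderiv_symm_toHomeo, D.toHomeo.symm_apply_apply,
    ← ContinuousLinearMap.comp_apply, ← ContinuousLinearMap.adjoint_comp, ← D.coe_fderivEquiv,
    ContinuousLinearEquiv.coe_symm_comp_coe]
  exact ext_inner_right ℝ fun e => by rw [ContinuousLinearMap.adjoint_inner_left]; rfl

lemma le_norm_pullGrad (G : E N → E N) (x : E N) :
    D.ratio * ‖G x‖ ≤ ‖D.pullGrad G (D.toHomeo x)‖ := by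
  have hop : ‖ContinuousLinearMap.adjoint (fderiv ℝ D.toHomeo x)‖ ≤ (D.ratio : ℝ)⁻¹ := by
    rw [LinearIsometryEquiv.norm_map]
    exact D.nnnorm_fderiv_toHomeo_le x
  have hle := ContinuousLinearMap.le_of_opNorm_le _ hop (D.pullGrad G (D.toHomeo x))
  rwa [D.adjoint_pullGrad, le_inv_mul_iff₀ (by exact_mod_cast D.ratio_pos)] at hle

lemma pullGrad_sub (G H : E N → E N) (y : E N) :
    D.pullGrad G y - D.pullGrad H y = D.pullGrad (fun x => G x - H x) y := by
  simp [pullGrad]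

lemma aestronglyMeasurable_comp_symm {F : Type*} [TopologicalSpace F]
    {f : E N → F} (hf : AEStronglyMeasurable f volume) :
    AEStronglyMeasurable (fun y => f (D.toHomeo.symm y)) volume :=
  hf.comp_quasiMeasurePreserving D.isJacobian.quasiMeasurePreserving_symm

lemma aestronglyMeasurable_pullGrad {G : E N → E N} (hG : AEStronglyMeasurable G volume) :
    AEStronglyMeasurable (D.pullGrad G) volume := by
  have hadj : Continuous fun y => ContinuousLinearMap.adjoint (fderiv ℝ D.toHomeo.symm y) :=
    (LinearIsometryEquiv.continuous _).comp (D.contDiff_symm.continuous_fderiv one_ne_zero)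
  exact isBoundedBilinearMap_apply.continuous.comp_aestronglyMeasurable
    (hadj.aestronglyMeasurable.prodMk (D.aestronglyMeasurable_comp_symm hG))

lemma locallyIntegrable_pullGrad {G : E N → E N} (hG : LocallyIntegrable G volume) :
    LocallyIntegrable (D.pullGrad G) volume :=
  locallyIntegrable_iff.2 fun _ hK =>
    (((D.locallyIntegrable_comp_symm hG).integrableOn_isCompact hK).norm.const_mul _).mono'
      (D.aestronglyMeasurable_pullGrad hG.aestronglyMeasurable).restrict
      (Eventually.of_forall (D.norm_pullGrad_le G))

lemma setIntegral_norm_pullGrad_le {G : E N → E N} (hG : LocallyIntegrable G volume)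
    {K : Set (E N)} (hK : IsCompact K) :
    ∫ y in K, ‖D.pullGrad G y‖ ≤
      (D.ratio : ℝ)⁻¹ * ((D.ratio : ℝ)⁻¹ ^ N * ∫ x in D.toHomeo.symm '' K, ‖G x‖) := by
  calc ∫ y in K, ‖D.pullGrad G y‖ ≤ ∫ y in K, (D.ratio : ℝ)⁻¹ * ‖G (D.toHomeo.symm y)‖ :=
        setIntegral_mono ((D.locallyIntegrable_pullGrad hG).integrableOn_isCompact hK).norm
          (((D.locallyIntegrable_comp_symm hG).integrableOn_isCompact hK).norm.const_mul _)
          (D.norm_pullGrad_le G)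
    _ ≤ _ := by
        rw [integral_const_mul]
        gcongr
        exact D.setIntegral_norm_comp_symm_le
          (hG.integrableOn_isCompact (hK.image D.toHomeo.symm.continuous))

lemma gradient_comp_symm {v : E N → ℝ} (hv : ContDiff ℝ 1 v) :
    gradient (fun y => v (D.toHomeo.symm y)) = D.pullGrad (gradient v) := by
  ext1 y
  refine ext_inner_right ℝ fun e => ?_
  have hchain := ((hv.differentiable one_ne_zero (D.toHomeo.symm y)).hasFDerivAt.comp y
    (D.contDiff_symm.differentiable one_ne_zero y).hasFDerivAt).fderiv
  rw [inner_gradient_left, pullGrad, ContinuousLinearMap.adjoint_inner_left, inner_gradient_left]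
  exact DFunLike.congr_fun hchain e

theorem isWeakGradient_comp_symm {u : E N → ℝ} {G : E N → E N} (h : IsWeakGradient u G) :
    IsWeakGradient (fun y => u (D.toHomeo.symm y)) (D.pullGrad G) := by
  refine isWeakGradient_of_approx (D.locallyIntegrable_comp_symm h.1)
    (D.locallyIntegrable_pullGrad h.2.1) fun K hK ε hε => ?_
  have hK' : IsCompact (D.toHomeo.symm '' K) := hK.image D.toHomeo.symm.continuous
  obtain ⟨η, hη, hηε⟩ := exists_pos_mul_lt hε
    ((D.ratio : ℝ)⁻¹ ^ N + (D.ratio : ℝ)⁻¹ * (D.ratio : ℝ)⁻¹ ^ N)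
  obtain ⟨v, hv, hu, hG⟩ := h.exists_contDiff_approx hK' hη
  have hv₁ : ContDiff ℝ 1 v := hv.of_le (by exact_mod_cast le_top)
  have hvw := isWeakGradient_gradient hv₁
  have hcomp := isWeakGradient_gradient (hv₁.comp D.contDiff_symm)
  refine ⟨fun y => v (D.toHomeo.symm y), D.pullGrad (gradient v),
    D.gradient_comp_symm hv₁ ▸ hcomp, ?_⟩
  simp only [pullGrad_sub]
  calc (∫ y in K, ‖u (D.toHomeo.symm y) - v (D.toHomeo.symm y)‖)
        + ∫ y in K, ‖D.pullGrad (fun x => G x - gradient v x) y‖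
      ≤ (D.ratio : ℝ)⁻¹ ^ N * (∫ x in D.toHomeo.symm '' K, ‖u x - v x‖) + (D.ratio : ℝ)⁻¹ *
          ((D.ratio : ℝ)⁻¹ ^ N * ∫ x in D.toHomeo.symm '' K, ‖G x - gradient v x‖) :=
        add_le_add (D.setIntegral_norm_comp_symm_le
          ((h.1.sub hvw.1).integrableOn_isCompact hK'))
          (D.setIntegral_norm_pullGrad_le (h.2.1.sub hvw.2.1) hK)
    _ ≤ (D.ratio : ℝ)⁻¹ ^ N * η + (D.ratio : ℝ)⁻¹ * ((D.ratio : ℝ)⁻¹ ^ N * η) := by gcongr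
    _ = ((D.ratio : ℝ)⁻¹ ^ N + (D.ratio : ℝ)⁻¹ * (D.ratio : ℝ)⁻¹ ^ N) * η := by ring
    _ ≤ ε := hηε.le

lemma hasWeakGradient_comp_symm {u : E N → ℝ} (h : HasWeakGradient u) :
    HasWeakGradient (fun y => u (D.toHomeo.symm y)) :=
  ⟨_, D.isWeakGradient_comp_symm h.isWeakGradient⟩

lemma weakGrad_comp_symm {u : E N → ℝ} (h : HasWeakGradient u) :
    weakGrad (fun y => u (D.toHomeo.symm y)) =ᵐ[volume] D.pullGrad (weakGrad u) :=
  (D.hasWeakGradient_comp_symm h).isWeakGradient.ae_eq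
    (D.isWeakGradient_comp_symm h.isWeakGradient)

end Perturbation

end WeakGradient

section Displacement

variable {N : ℕ}

lemma exists_norm_dilField_le {R : ℝ} (hR : 1 ≤ R) : ∃ B, ∀ x : E N, ‖dilField R x‖ ≤ B :=
  (HasCompactSupport.intro (isCompact_annulus R)
    fun _ => dilField_of_notMem_annulus hR).exists_bound_of_continuous
    (contDiff_dilField R).continuous

lemma norm_sub_comp_sub_smul_le {v : E N → ℝ} (hv : ContDiff ℝ 1 v) {t : ℝ} (ht : 0 ≤ t)
    (x X : E N) :
    ‖v x - v (x - t • X)‖ ≤ ∫ s in Set.Ioc 0 t, ‖X‖ * ‖gradient v (x - s • X)‖ := by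
  have hline : Continuous fun s : ℝ => x - s • X := by fun_prop
  have hderiv (s : ℝ) : HasDerivAt (fun s : ℝ => v (x - s • X))
      (fderiv ℝ v (x - s • X) (-X)) s := by
    refine (hv.differentiable one_ne_zero _).hasFDerivAt.comp_hasDerivAt s ?_
    simpa using ((hasDerivAt_id s).smul_const X).const_sub x
  have hderiv_cont : Continuous fun s : ℝ => fderiv ℝ v (x - s • X) (-X) :=
    ((hv.continuous_fderiv one_ne_zero).comp hline).clm_apply continuous_const
  have hbound_cont : Continuous fun s : ℝ => ‖X‖ * ‖gradient v (x - s • X)‖ :=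
    continuous_const.mul ((continuous_gradient hv).comp hline).norm
  have hftc := intervalIntegral.integral_eq_sub_of_hasDerivAt (a := 0) (b := t)
    (fun s _ => hderiv s) (hderiv_cont.intervalIntegrable _ _)
  rw [zero_smul, sub_zero] at hftc
  rw [norm_sub_rev, ← hftc, ← intervalIntegral.integral_of_le ht]
  refine intervalIntegral.norm_integral_le_of_norm_le ht
    (Eventually.of_forall fun s _ => ?_) (hbound_cont.intervalIntegrable _ _)
  rw [← inner_gradient_left]
  exact (norm_inner_le_norm _ _).trans_eq (by rw [norm_neg, mul_comm])

namespace Step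

variable (z : Step N)

/-- The step with the same scale and the smaller step size `s`. -/
def withTime {s : ℝ} (hs : s ∈ Set.Ioc 0 z.t) : Step N where
  R := z.R
  t := s
  one_le_R := z.one_le_R
  t_pos := hs.1
  t_le_half := hs.2.trans z.t_le_half
  t_mul_dilLip_le := (mul_le_mul_of_nonneg_right hs.2 (dilLip N).coe_nonneg).trans
    z.t_mul_dilLip_le

lemma setIntegral_annulus_comp_symm_le {F : Type*} [NormedAddCommGroup F] {f : E N → F}
    (hf : LocallyIntegrable f volume) :
    ∫ y in annulus N z.R, ‖f (z.deform.toHomeo.symm y)‖ ≤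
      2 ^ N * ∫ x in annulus N z.R, ‖f x‖ := by
  have hle := z.deform.setIntegral_norm_comp_symm_le (f := f) (K := annulus N z.R)
    (by rw [deform_symm_image_annulus]; exact hf.integrableOn_isCompact (isCompact_annulus _))
  rw [deform_symm_image_annulus] at hle
  exact hle.trans (by gcongr; exact z.inv_ratio_deform_le)

lemma one_le_two_pow_mul_jac (x : E N) : 1 ≤ 2 ^ N * (z.deform.jac x : ℝ) := by
  have hratio := z.half_le_ratio_deform
  calc (1 : ℝ) = 2 ^ N * (1 / 2) ^ N := by rw [← mul_pow]; norm_num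
    _ ≤ 2 ^ N * (z.deform.ratio : ℝ) ^ N := by gcongr
    _ ≤ 2 ^ N * (z.deform.jac x : ℝ) := by
        gcongr; exact_mod_cast z.deform.ratio_pow_le_jac x

lemma setIntegral_annulus_jac_mul (g : E N → ℝ) :
    ∫ x in annulus N z.R, (z.deform.jac x : ℝ) * g (z.deform.toHomeo x) =
      ∫ x in annulus N z.R, g x := by
  have hA := (isCompact_annulus (N := N) z.R).measurableSet
  rw [← integral_indicator hA, ← integral_indicator hA,
    z.deform.isJacobian.integral_eq ((annulus N z.R).indicator g)]
  refine integral_congr_ae (Eventually.of_forall fun x => ?_)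
  change _ = z.deform.jac x • (annulus N z.R).indicator g (z.deform.toHomeo x)
  by_cases hx : x ∈ annulus N z.R
  · rw [Set.indicator_of_mem hx, Set.indicator_of_mem (z.deform_mem_annulus_iff.2 hx)]
    rfl
  · rw [Set.indicator_of_notMem hx,
      Set.indicator_of_notMem (mt z.deform_mem_annulus_iff.1 hx), smul_zero]

lemma setIntegral_annulus_comp_le {g : E N → ℝ} (hg : Continuous g) (hg₀ : ∀ x, 0 ≤ g x) :
    ∫ x in annulus N z.R, g (z.deform.toHomeo x) ≤ 2 ^ N * ∫ x in annulus N z.R, g x := by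
  have hA := isCompact_annulus (N := N) z.R
  have hcomp : Continuous fun x => g (z.deform.toHomeo x) := hg.comp z.deform.toHomeo.continuous
  have hjac : Continuous fun x => (z.deform.jac x : ℝ) * g (z.deform.toHomeo x) :=
    (NNReal.continuous_coe.comp z.deform.continuous_jac).mul hcomp
  rw [← z.setIntegral_annulus_jac_mul g, ← integral_const_mul]
  refine setIntegral_mono (hcomp.continuousOn.integrableOn_compact hA)
    ((hjac.continuousOn.integrableOn_compact hA).const_mul _) fun x => ?_
  simp only [← mul_assoc]
  exact le_mul_of_one_le_left (hg₀ _) (z.one_le_two_pow_mul_jac x)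

lemma setIntegral_annulus_gradient_comp_sub_smul_le {v : E N → ℝ} (hv : ContDiff ℝ 1 v) {B : ℝ}
    (hB : ∀ x : E N, ‖dilField z.R x‖ ≤ B) {s : ℝ} (hs : s ∈ Set.Ioc 0 z.t) :
    ∫ x in annulus N z.R, ‖dilField z.R x‖ * ‖gradient v (x - s • dilField z.R x)‖ ≤
      B * 2 ^ N * ∫ x in annulus N z.R, ‖gradient v x‖ := by
  have hA := isCompact_annulus (N := N) z.R
  have hB₀ : 0 ≤ B := (norm_nonneg _).trans (hB 0)
  have hX : Continuous (dilField z.R : E N → E N) := (contDiff_dilField z.R).continuous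
  have hflow : Continuous fun x => ‖gradient v ((z.withTime hs).deform.toHomeo x)‖ :=
    ((continuous_gradient hv).comp (z.withTime hs).deform.toHomeo.continuous).norm
  calc _ ≤ ∫ x in annulus N z.R, B * ‖gradient v ((z.withTime hs).deform.toHomeo x)‖ :=
        setIntegral_mono ((hX.norm.mul hflow).continuousOn.integrableOn_compact hA)
          ((hflow.continuousOn.integrableOn_compact hA).const_mul B)
          fun x => mul_le_mul_of_nonneg_right (hB x) (norm_nonneg _)
    _ ≤ _ := by
        rw [integral_const_mul, mul_assoc]
        gcongr
        exact (z.withTime hs).setIntegral_annulus_comp_le (continuous_gradient hv).norm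
          fun _ => norm_nonneg _

lemma setIntegral_annulus_sub_deform_le {v : E N → ℝ} (hv : ContDiff ℝ 1 v) {B : ℝ}
    (hB : ∀ x : E N, ‖dilField z.R x‖ ≤ B) :
    ∫ x in annulus N z.R, ‖v x - v (z.deform.toHomeo x)‖ ≤
      z.t * (B * 2 ^ N * ∫ x in annulus N z.R, ‖gradient v x‖) := by
  have hA := isCompact_annulus (N := N) z.R
  have hX : Continuous (dilField z.R : E N → E N) := (contDiff_dilField z.R).continuous
  have hjoint : Continuous fun w : E N × ℝ =>
      ‖dilField z.R w.1‖ * ‖gradient v (w.1 - w.2 • dilField z.R w.1)‖ :=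
    (hX.comp continuous_fst).norm.mul ((continuous_gradient hv).comp
      (continuous_fst.sub (continuous_snd.smul (hX.comp continuous_fst)))).norm
  have hint : Integrable (fun w : E N × ℝ =>
        ‖dilField z.R w.1‖ * ‖gradient v (w.1 - w.2 • dilField z.R w.1)‖)
      ((volume.restrict (annulus N z.R)).prod (volume.restrict (Set.Ioc 0 z.t))) := by
    rw [Measure.prod_restrict]
    exact (hjoint.continuousOn.integrableOn_compact (hA.prod isCompact_Icc)).mono_set
      (Set.prod_mono_right Set.Ioc_subset_Icc_self)
  calc ∫ x in annulus N z.R, ‖v x - v (z.deform.toHomeo x)‖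
      ≤ ∫ x in annulus N z.R, ∫ s in Set.Ioc 0 z.t,
          ‖dilField z.R x‖ * ‖gradient v (x - s • dilField z.R x)‖ :=
        setIntegral_mono ((hv.continuous.sub (hv.continuous.comp
            z.deform.toHomeo.continuous)).norm.continuousOn.integrableOn_compact hA)
          hint.integral_prod_left fun x => norm_sub_comp_sub_smul_le hv z.t_pos.le x _
    _ = ∫ s in Set.Ioc 0 z.t, ∫ x in annulus N z.R,
          ‖dilField z.R x‖ * ‖gradient v (x - s • dilField z.R x)‖ := integral_integral_swap hint
    _ ≤ ∫ _ in Set.Ioc 0 z.t, B * 2 ^ N * ∫ x in annulus N z.R, ‖gradient v x‖ :=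
        setIntegral_mono_on hint.integral_prod_right (integrable_const _) measurableSet_Ioc
          fun _ hs => z.setIntegral_annulus_gradient_comp_sub_smul_le hv hB hs
    _ = z.t * (B * 2 ^ N * ∫ x in annulus N z.R, ‖gradient v x‖) := by simp [z.t_pos.le]

lemma setIntegral_annulus_transport_sub_le_of_contDiff {v : E N → ℝ} (hv : ContDiff ℝ 1 v) {B : ℝ}
    (hB : ∀ x : E N, ‖dilField z.R x‖ ≤ B) :
    ∫ y in annulus N z.R, ‖v (z.deform.toHomeo.symm y) - v y‖ ≤
      z.t * (B * 4 ^ N * ∫ x in annulus N z.R, ‖gradient v x‖) := by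
  have hcomp := z.setIntegral_annulus_comp_symm_le (f := fun x => v x - v (z.deform.toHomeo x))
    (hv.continuous.sub (hv.continuous.comp z.deform.toHomeo.continuous)).locallyIntegrable
  simp only [Homeomorph.apply_symm_apply] at hcomp
  calc _ ≤ 2 ^ N * (z.t * (B * 2 ^ N * ∫ x in annulus N z.R, ‖gradient v x‖)) :=
        hcomp.trans (by gcongr; exact z.setIntegral_annulus_sub_deform_le hv hB)
    _ = z.t * (B * (2 * 2) ^ N * ∫ x in annulus N z.R, ‖gradient v x‖) := by rw [mul_pow]; ring
    _ = _ := by norm_num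

lemma setIntegral_annulus_transport_sub_le_add {u v : E N → ℝ} (hu : LocallyIntegrable u volume)
    (hv : LocallyIntegrable v volume) :
    ∫ y in annulus N z.R, ‖u (z.deform.toHomeo.symm y) - u y‖ ≤
      (∫ y in annulus N z.R, ‖v (z.deform.toHomeo.symm y) - v y‖)
        + (2 ^ N + 1) * ∫ y in annulus N z.R, ‖u y - v y‖ := by
  have hA := isCompact_annulus (N := N) z.R
  have hu' := z.deform.locallyIntegrable_comp_symm hu
  have hv' := z.deform.locallyIntegrable_comp_symm hv
  have hint {f g : E N → ℝ} (hf : LocallyIntegrable f volume) (hg : LocallyIntegrable g volume) :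
      IntegrableOn (fun y => ‖f y - g y‖) (annulus N z.R) volume :=
    ((hf.sub hg).integrableOn_isCompact hA).norm
  have hint₁₂ : IntegrableOn (fun y => ‖u (z.deform.toHomeo.symm y) - v (z.deform.toHomeo.symm y)‖
      + ‖v (z.deform.toHomeo.symm y) - v y‖) (annulus N z.R) volume :=
    (hint hu' hv').add (hint hv' hv)
  have hcomp := z.setIntegral_annulus_comp_symm_le (hu.sub hv)
  simp only [Pi.sub_apply] at hcomp
  calc ∫ y in annulus N z.R, ‖u (z.deform.toHomeo.symm y) - u y‖
      ≤ ∫ y in annulus N z.R, (‖u (z.deform.toHomeo.symm y) - v (z.deform.toHomeo.symm y)‖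
          + ‖v (z.deform.toHomeo.symm y) - v y‖ + ‖u y - v y‖) := by
        refine setIntegral_mono (hint hu' hu) (hint₁₂.add (hint hu hv)) fun y => ?_
        calc ‖u (z.deform.toHomeo.symm y) - u y‖
            = ‖(u (z.deform.toHomeo.symm y) - v (z.deform.toHomeo.symm y))
              + (v (z.deform.toHomeo.symm y) - v y) - (u y - v y)‖ := by congr 1; abel
          _ ≤ _ := (norm_sub_le _ _).trans (by gcongr; exact norm_add_le _ _)
    _ = (∫ y in annulus N z.R, ‖u (z.deform.toHomeo.symm y) - v (z.deform.toHomeo.symm y)‖)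
          + (∫ y in annulus N z.R, ‖v (z.deform.toHomeo.symm y) - v y‖)
          + ∫ y in annulus N z.R, ‖u y - v y‖ := by
        rw [integral_add hint₁₂ (hint hu hv), integral_add (hint hu' hv') (hint hv' hv)]
    _ ≤ _ := by linarith

theorem setIntegral_annulus_transport_sub_le {u : E N → ℝ} {G : E N → E N}
    (hu : IsWeakGradient u G) {B : ℝ} (hB : ∀ x : E N, ‖dilField z.R x‖ ≤ B) :
    ∫ y in annulus N z.R, ‖u (z.deform.toHomeo.symm y) - u y‖ ≤
      z.t * (B * 4 ^ N * ∫ x in annulus N z.R, ‖G x‖) := by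
  have hA := isCompact_annulus (N := N) z.R
  have hB₀ : 0 ≤ B := (norm_nonneg _).trans (hB 0)
  have ht := z.t_pos
  refine le_of_forall_pos_le_add fun ε hε => ?_
  obtain ⟨η, hη, hηε⟩ := exists_pos_mul_lt hε (z.t * (B * 4 ^ N) + (2 ^ N + 1))
  obtain ⟨v, hv, huv, hGv⟩ := hu.exists_contDiff_approx hA hη
  have hv₁ : ContDiff ℝ 1 v := hv.of_le (by exact_mod_cast le_top)
  have hG := hu.2.1.integrableOn_isCompact hA
  have hgrad := (continuous_gradient hv₁).continuousOn.integrableOn_compact (μ := volume) hA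
  have hgrad_le : ∫ x in annulus N z.R, ‖gradient v x‖ ≤ (∫ x in annulus N z.R, ‖G x‖) + η := by
    calc ∫ x in annulus N z.R, ‖gradient v x‖
        ≤ ∫ x in annulus N z.R, (‖G x‖ + ‖G x - gradient v x‖) :=
          setIntegral_mono hgrad.norm (hG.norm.add (hG.sub hgrad).norm) fun x =>
            norm_le_norm_add_norm_sub _ _
      _ = (∫ x in annulus N z.R, ‖G x‖) + ∫ x in annulus N z.R, ‖G x - gradient v x‖ :=
          integral_add hG.norm (hG.sub hgrad).norm
      _ ≤ _ := by gcongr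
  calc ∫ y in annulus N z.R, ‖u (z.deform.toHomeo.symm y) - u y‖
      ≤ (∫ y in annulus N z.R, ‖v (z.deform.toHomeo.symm y) - v y‖)
        + (2 ^ N + 1) * ∫ y in annulus N z.R, ‖u y - v y‖ :=
        z.setIntegral_annulus_transport_sub_le_add hu.1 hv₁.continuous.locallyIntegrable
    _ ≤ z.t * (B * 4 ^ N * ((∫ x in annulus N z.R, ‖G x‖) + η)) + (2 ^ N + 1) * η := by
        gcongr
        exact (z.setIntegral_annulus_transport_sub_le_of_contDiff hv₁ hB).trans (by gcongr)
    _ = z.t * (B * 4 ^ N * ∫ x in annulus N z.R, ‖G x‖)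
          + (z.t * (B * 4 ^ N) + (2 ^ N + 1)) * η := by ring
    _ ≤ _ := by gcongr

end Step

end Displacement

section Remainder

lemma exists_dist_le_add_mul_dist {X Y : Type*} [PseudoMetricSpace X] [PseudoMetricSpace Y]
    {f : X → Y} {K : Set X} (hK : IsCompact K) (hf : ContinuousOn f K) {ε : ℝ} (hε : 0 < ε) :
    ∃ C, 0 ≤ C ∧ ∀ a ∈ K, ∀ b ∈ K, dist (f a) (f b) ≤ ε + C * dist a b := by
  obtain ⟨δ, hδ, hunif⟩ := Metric.uniformContinuousOn_iff.1
    (hK.uniformContinuousOn_of_continuous hf) ε hε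
  have : 0 ≤ Metric.diam (f '' K) := Metric.diam_nonneg
  refine ⟨Metric.diam (f '' K) / δ, by positivity, fun a ha b hb => ?_⟩
  rcases lt_or_ge (dist a b) δ with hab | hab
  · exact (hunif a ha b hb hab).le.trans (le_add_of_nonneg_right (by positivity))
  · calc dist (f a) (f b) ≤ Metric.diam (f '' K) :=
          Metric.dist_le_diam_of_mem (hK.image_of_continuousOn hf).isBounded
            (Set.mem_image_of_mem f ha) (Set.mem_image_of_mem f hb)
      _ ≤ Metric.diam (f '' K) / δ * dist a b := by rw [div_mul_eq_mul_div, le_div_iff₀ hδ]; gcongr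
      _ ≤ _ := le_add_of_nonneg_left hε.le

lemma continuous_Phi {q : ℝ} (hq : 1 < q) : Continuous (Phi q) := by
  have hq₁ : 0 < q - 1 := sub_pos.2 hq
  have hpow {t : ℝ} (ht : 0 < t) : t ^ (q - 2) * t = t ^ (q - 1) := by
    rw [← Real.rpow_add_one ht.ne']; ring_nf
  have hsplit : Phi q = fun t => max t 0 ^ (q - 1) - max (-t) 0 ^ (q - 1) := by
    ext1 t
    rcases lt_trichotomy t 0 with ht | rfl | ht
    · rw [Phi, abs_of_neg ht, max_eq_right ht.le, max_eq_left (neg_pos.2 ht).le,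
        Real.zero_rpow hq₁.ne', ← hpow (neg_pos.2 ht)]
      ring
    · simp [Phi]
    · rw [Phi, abs_of_pos ht, max_eq_left ht.le, max_eq_right (neg_neg_iff_pos.2 ht).le,
        Real.zero_rpow hq₁.ne', hpow ht, sub_zero]
  rw [hsplit]
  exact ((continuous_id.max continuous_const).rpow_const fun _ => Or.inr hq₁.le).sub
    ((continuous_neg.max continuous_const).rpow_const fun _ => Or.inr hq₁.le)

variable {N : ℕ}

lemma exists_norm_rpow_le_on_annulus (N : ℕ) {R : ℝ} (hR : 0 < R) (α : ℝ) :
    ∃ k, 0 ≤ k ∧ ∀ y ∈ annulus N R, ‖y‖ ^ α ≤ k := by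
  have hne {y : E N} (hy : y ∈ annulus N R) : ‖y‖ ≠ 0 := ((inv_pos.2 hR).trans_le hy.1).ne'
  obtain ⟨k, hk⟩ := (isCompact_annulus (N := N) R).bddAbove_image
    (continuous_norm.continuousOn.rpow_const (p := α) fun y hy => Or.inl (hne hy))
  exact ⟨max k 0, le_max_right _ _, fun y hy =>
    (hk (Set.mem_image_of_mem _ hy)).trans (le_max_left _ _)⟩

namespace Step

lemma exists_transport_sub_le_of_contDiff {v : E N → ℝ} (hv : ContDiff ℝ 1 v) {R : ℝ}
    (hR : 1 ≤ R) :
    ∃ C, 0 ≤ C ∧ ∀ z : Step N, z.R = R → ∀ y ∈ annulus N R,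
      ‖v (z.deform.toHomeo.symm y) - v y‖ ≤ C * z.t := by
  obtain ⟨B, hB⟩ := exists_norm_dilField_le (N := N) hR
  obtain ⟨C, hC⟩ := (isCompact_closedBall (0 : E N) (2 * R)).exists_bound_of_continuousOn
    (f := fderiv ℝ v) (hv.continuous_fderiv one_ne_zero).continuousOn
  have hC₀ : 0 ≤ C := (norm_nonneg _).trans (hC 0 (Metric.mem_closedBall_self (by positivity)))
  have hB₀ : 0 ≤ B := (norm_nonneg _).trans (hB 0)
  refine ⟨C * B, by positivity, ?_⟩
  rintro z rfl y hy
  have hball {w : E N} (hw : w ∈ annulus N z.R) : w ∈ Metric.closedBall (0 : E N) (2 * z.R) := by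
    simpa using hw.2
  have hx : z.deform.toHomeo.symm y ∈ annulus N z.R := by
    rw [← z.deform_symm_image_annulus]
    exact Set.mem_image_of_mem _ hy
  have hmove : ‖z.deform.toHomeo.symm y - y‖ ≤ z.t * B := by
    nth_rewrite 2 [← z.deform.toHomeo.apply_symm_apply y]
    rw [deform_apply, sub_sub_cancel, norm_smul, Real.norm_of_nonneg z.t_pos.le]
    have ht := z.t_pos
    gcongr
    exact hB _
  calc ‖v (z.deform.toHomeo.symm y) - v y‖ ≤ C * ‖z.deform.toHomeo.symm y - y‖ :=
        (convex_closedBall (0 : E N) (2 * z.R)).norm_image_sub_le_of_norm_fderiv_le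
          (fun w _ => hv.differentiable one_ne_zero w) hC (hball hy) (hball hx)
    _ ≤ C * (z.t * B) := by gcongr
    _ = C * B * z.t := by ring

lemma exists_transport_sub_le_add {u : E N → ℝ} {G : E N → E N} (hu : IsWeakGradient u G) {R : ℝ}
    (hR : 1 ≤ R) {ε : ℝ} (hε : 0 < ε) :
    ∃ C, 0 ≤ C ∧ ∀ z : Step N, z.R = R → ∃ ρ : E N → ℝ, (∀ y, 0 ≤ ρ y) ∧
      IntegrableOn ρ (annulus N R) volume ∧ ∫ y in annulus N R, ρ y ≤ z.t * ε ∧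
      ∀ y ∈ annulus N R, |u (z.deform.toHomeo.symm y) - u y| ≤ ρ y + C * z.t := by
  have hA := isCompact_annulus (N := N) R
  obtain ⟨B, hB⟩ := exists_norm_dilField_le (N := N) hR
  have hB₀ : 0 ≤ B := (norm_nonneg _).trans (hB 0)
  obtain ⟨η, hη, hηε⟩ := exists_pos_mul_lt hε (B * 4 ^ N)
  obtain ⟨v, hv, -, hGv⟩ := hu.exists_contDiff_approx hA hη
  have hv₁ : ContDiff ℝ 1 v := hv.of_le (by exact_mod_cast le_top)
  have huv := hu.sub (isWeakGradient_gradient hv₁)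
  obtain ⟨C, hC₀, hC⟩ := exists_transport_sub_le_of_contDiff hv₁ hR
  refine ⟨C, hC₀, ?_⟩
  rintro z rfl
  refine ⟨fun y => ‖u (z.deform.toHomeo.symm y) - v (z.deform.toHomeo.symm y) - (u y - v y)‖,
    fun _ => norm_nonneg _,
    (((z.deform.locallyIntegrable_comp_symm huv.1).sub huv.1).integrableOn_isCompact hA).norm,
    (z.setIntegral_annulus_transport_sub_le huv hB).trans ?_, fun y hy => ?_⟩
  · have ht := z.t_pos
    gcongr
    exact (mul_le_mul_of_nonneg_left hGv.le (by positivity)).trans hηε.le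
  · calc |u (z.deform.toHomeo.symm y) - u y|
        = ‖u (z.deform.toHomeo.symm y) - v (z.deform.toHomeo.symm y) - (u y - v y)
            + (v (z.deform.toHomeo.symm y) - v y)‖ := by rw [Real.norm_eq_abs]; congr 1; ring
      _ ≤ _ := (norm_add_le _ _).trans (by gcongr; exact hC z rfl y hy)

/-- The error made in the source term by replacing `Φ_q(u)` by `Φ_q` of the transported
function. -/
def remainder (z : Step N) (q α : ℝ) (u : E N → ℝ) (y : E N) : ℝ :=
  ‖y‖ ^ α * (|Phi q (u (z.deform.toHomeo.symm y)) - Phi q (u y)|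
    * |u (z.deform.toHomeo.symm y) - u y|)

lemma remainder_of_notMem_annulus (z : Step N) (q α : ℝ) (u : E N → ℝ) {y : E N}
    (hy : y ∉ annulus N z.R) : z.remainder q α u y = 0 := by
  simp [remainder, z.deform_symm_of_notMem_annulus hy]

section

variable {u : E N → ℝ} {M q : ℝ} (z : Step N)

lemma ae_abs_comp_symm_le (hM : ∀ᵐ x, |u x| ≤ M) : ∀ᵐ y, |u (z.deform.toHomeo.symm y)| ≤ M :=
  z.deform.isJacobian.quasiMeasurePreserving_symm.ae hM

lemma ae_abs_Phi_sub_le (hM : ∀ᵐ x, |u x| ≤ M) (hq : 1 < q) :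
    ∀ᵐ y, |Phi q (u (z.deform.toHomeo.symm y)) - Phi q (u y)| ≤
      Metric.diam (Phi q '' Set.Icc (-M) M) := by
  filter_upwards [hM, z.ae_abs_comp_symm_le hM] with y hy hy'
  exact Metric.dist_le_diam_of_mem
    (isCompact_Icc.image_of_continuousOn (continuous_Phi hq).continuousOn).isBounded
    (Set.mem_image_of_mem _ (abs_le.1 hy')) (Set.mem_image_of_mem _ (abs_le.1 hy))

lemma integrable_remainder (hu : LocallyIntegrable u volume) (hM : ∀ᵐ x, |u x| ≤ M) (hq : 1 < q)
    (α : ℝ) : Integrable (z.remainder q α u) volume := by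
  have hA := isCompact_annulus (N := N) z.R
  have hu' := z.deform.locallyIntegrable_comp_symm hu
  obtain ⟨k, hk₀, hk⟩ := exists_norm_rpow_le_on_annulus N z.R_pos α
  have hmeas : AEStronglyMeasurable (fun y => ‖y‖ ^ α *
      |Phi q (u (z.deform.toHomeo.symm y)) - Phi q (u y)|) volume :=
    (measurable_norm.pow_const α).aestronglyMeasurable.mul
      (((continuous_Phi hq).comp_aestronglyMeasurable hu'.aestronglyMeasurable).sub
        ((continuous_Phi hq).comp_aestronglyMeasurable hu.aestronglyMeasurable)).norm
  refine (integrableOn_iff_integrable_of_support_subset fun y hy => by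
    by_contra hyA
    exact hy (z.remainder_of_notMem_annulus q α u hyA)).1 ?_
  refine (((hu'.sub hu).integrableOn_isCompact hA).norm.bdd_mul hmeas.restrict
    (c := k * Metric.diam (Phi q '' Set.Icc (-M) M)) ?_).congr
    (Eventually.of_forall fun y => mul_assoc _ _ _)
  refine (ae_restrict_iff' hA.measurableSet).2 ?_
  filter_upwards [z.ae_abs_Phi_sub_le hM hq] with y hy hyA
  rw [Real.norm_of_nonneg (by positivity)]
  exact mul_le_mul (hk y hyA) hy (abs_nonneg _) hk₀

/-- Where the displacement is at most `c`, continuity of `Φ_q` makes the other factor small;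
for the excess `ρ` of the displacement over `c` that factor is merely bounded. -/
lemma ae_remainder_le (hM : ∀ᵐ x, |u x| ≤ M) (hq : 1 < q) {α k c ε C : ℝ} (hk₀ : 0 ≤ k)
    (hk : ∀ y ∈ annulus N z.R, ‖y‖ ^ α ≤ k) {ρ : E N → ℝ} (hρ₀ : ∀ y, 0 ≤ ρ y) (hc : 0 ≤ c)
    (hmove : ∀ y ∈ annulus N z.R, |u (z.deform.toHomeo.symm y) - u y| ≤ ρ y + c)
    (hΦ : ∀ a ∈ Set.Icc (-M) M, ∀ b ∈ Set.Icc (-M) M,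
      dist (Phi q a) (Phi q b) ≤ ε + C * dist a b) :
    ∀ᵐ y ∂volume.restrict (annulus N z.R), z.remainder q α u y ≤
      k * (Metric.diam (Phi q '' Set.Icc (-M) M) * ρ y
        + c * (ε + C * ‖u (z.deform.toHomeo.symm y) - u y‖)) := by
  refine (ae_restrict_iff' (isCompact_annulus z.R).measurableSet).2 ?_
  filter_upwards [hM, z.ae_abs_comp_symm_le hM, z.ae_abs_Phi_sub_le hM hq] with y hy hy' hW hyA
  have hmod := hΦ _ (abs_le.1 hy') _ (abs_le.1 hy)
  rw [remainder]
  refine mul_le_mul (hk y hyA) ?_ (by positivity) hk₀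
  calc _ ≤ |Phi q (u (z.deform.toHomeo.symm y)) - Phi q (u y)| * (ρ y + c) := by
        gcongr; exact hmove y hyA
    _ = |Phi q (u (z.deform.toHomeo.symm y)) - Phi q (u y)| * ρ y
        + c * |Phi q (u (z.deform.toHomeo.symm y)) - Phi q (u y)| := by ring
    _ ≤ _ := add_le_add (mul_le_mul_of_nonneg_right hW (hρ₀ y)) (mul_le_mul_of_nonneg_left hmod hc)

lemma integral_remainder_le (hu : LocallyIntegrable u volume) (hM : ∀ᵐ x, |u x| ≤ M) (hq : 1 < q)
    {α k c ε C : ℝ} (hk₀ : 0 ≤ k) (hk : ∀ y ∈ annulus N z.R, ‖y‖ ^ α ≤ k) {ρ : E N → ℝ}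
    (hρ₀ : ∀ y, 0 ≤ ρ y) (hρ : IntegrableOn ρ (annulus N z.R) volume) (hc : 0 ≤ c)
    (hmove : ∀ y ∈ annulus N z.R, |u (z.deform.toHomeo.symm y) - u y| ≤ ρ y + c)
    (hΦ : ∀ a ∈ Set.Icc (-M) M, ∀ b ∈ Set.Icc (-M) M,
      dist (Phi q a) (Phi q b) ≤ ε + C * dist a b) :
    ∫ y, z.remainder q α u y ≤ k * (Metric.diam (Phi q '' Set.Icc (-M) M) *
        (∫ y in annulus N z.R, ρ y) + c * (ε * volume.real (annulus N z.R)
          + C * ∫ y in annulus N z.R, ‖u (z.deform.toHomeo.symm y) - u y‖)) := by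
  have hA := isCompact_annulus (N := N) z.R
  set W := Metric.diam (Phi q '' Set.Icc (-M) M)
  have hd : IntegrableOn (fun y => C * ‖u (z.deform.toHomeo.symm y) - u y‖)
      (annulus N z.R) volume :=
    (((z.deform.locallyIntegrable_comp_symm hu).sub hu).integrableOn_isCompact hA).norm.const_mul C
  have hε : IntegrableOn (fun _ : E N => ε) (annulus N z.R) volume :=
    integrableOn_const hA.measure_lt_top.ne
  have hεd : IntegrableOn (fun y => c * (ε + C * ‖u (z.deform.toHomeo.symm y) - u y‖))
      (annulus N z.R) volume := (hε.add hd).const_mul c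
  rw [← setIntegral_eq_integral_of_forall_compl_eq_zero fun y hy =>
    z.remainder_of_notMem_annulus q α u hy]
  calc _ ≤ ∫ y in annulus N z.R, k * (W * ρ y
          + c * (ε + C * ‖u (z.deform.toHomeo.symm y) - u y‖)) :=
        setIntegral_mono_ae_restrict (z.integrable_remainder hu hM hq α).integrableOn
          (((hρ.const_mul W).add hεd).const_mul k) (z.ae_remainder_le hM hq hk₀ hk hρ₀ hc hmove hΦ)
    _ = _ := by
        rw [integral_const_mul, integral_add (hρ.const_mul W) hεd, integral_const_mul,
          integral_const_mul, integral_add hε hd, integral_const_mul, setIntegral_const,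
          smul_eq_mul, mul_comm ε]

end

end Step

theorem integral_remainder_isLittleO {u : E N → ℝ} {G : E N → E N} (hu : IsWeakGradient u G)
    {M q : ℝ} (hM : ∀ᵐ x, |u x| ≤ M) (hq : 1 < q) (α : ℝ) :
    (fun z : Step N => ∫ y, z.remainder q α u y) =o[smallSteps N] fun z => z.t := by
  refine Asymptotics.isLittleO_iff.2 fun δ hδ => eventually_smallSteps_iff.2 ?_
  filter_upwards [eventually_ge_atTop 1] with R hR
  set W := Metric.diam (Phi q '' Set.Icc (-M) M)
  obtain ⟨B, hB⟩ := exists_norm_dilField_le (N := N) hR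
  set A := B * 4 ^ N * ∫ x in annulus N R, ‖G x‖
  obtain ⟨k, hk₀, hk⟩ := exists_norm_rpow_le_on_annulus N (one_pos.trans_le hR) α
  obtain ⟨ε₁, hε₁, hδ₁⟩ := exists_pos_mul_lt (div_pos hδ three_pos) (k * W)
  obtain ⟨C₁, hC₁, hmove⟩ := Step.exists_transport_sub_le_add hu hR hε₁
  obtain ⟨ε₂, hε₂, hδ₂⟩ :=
    exists_pos_mul_lt (div_pos hδ three_pos) (k * C₁ * volume.real (annulus N R))
  obtain ⟨C₂, hC₂, hΦ⟩ := exists_dist_le_add_mul_dist (isCompact_Icc (a := -M) (b := M))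
    (continuous_Phi hq).continuousOn hε₂
  obtain ⟨t₀, ht₀, hδ₃⟩ := exists_pos_mul_lt (div_pos hδ three_pos) (k * C₁ * C₂ * A)
  have hA : 0 ≤ A := mul_nonneg (mul_nonneg ((norm_nonneg _).trans (hB 0)) (by positivity))
    (integral_nonneg fun _ => norm_nonneg _)
  filter_upwards [nhdsWithin_le_nhds (eventually_lt_nhds ht₀)] with t ht
  rintro z rfl rfl
  obtain ⟨ρ, hρ₀, hρ, hρ_le, hρ_move⟩ := hmove z rfl
  have hz := z.t_pos
  have : 0 ≤ W := Metric.diam_nonneg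
  rw [Real.norm_of_nonneg (integral_nonneg fun y => by unfold Step.remainder; positivity),
    Real.norm_of_nonneg hz.le]
  calc ∫ y, z.remainder q α u y
      ≤ k * (W * (∫ y in annulus N z.R, ρ y) + C₁ * z.t * (ε₂ * volume.real (annulus N z.R)
          + C₂ * ∫ y in annulus N z.R, ‖u (z.deform.toHomeo.symm y) - u y‖)) :=
        z.integral_remainder_le hu.1 hM hq hk₀ hk hρ₀ hρ (by positivity) hρ_move hΦ
    _ ≤ k * (W * (z.t * ε₁) + C₁ * z.t * (ε₂ * volume.real (annulus N z.R)
          + C₂ * (t₀ * A))) := by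
        gcongr
        exact (z.setIntegral_annulus_transport_sub_le hu hB).trans (by gcongr)
    _ = z.t * (k * W * ε₁ + k * C₁ * volume.real (annulus N z.R) * ε₂ + k * C₁ * C₂ * A * t₀) := by
        ring
    _ ≤ z.t * (δ / 3 + δ / 3 + δ / 3) := by gcongr
    _ = δ * z.t := by ring

end Remainder

section Slope

variable {N : ℕ} {F G : Step N → ℝ} {F₀ G₀ a b : ℝ}

/-- `F z = F₀ + t (a + o(1))` for small inner variations `z` of step size `t`: the functional with
values `F z` has first variation `a`. -/
def HasSlope (F : Step N → ℝ) (F₀ a : ℝ) : Prop :=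
  (fun z => F z - F₀ - z.t * a) =o[smallSteps N] fun z => z.t

/-- `F z ≤ F₀ + t (a + o(1))` for small inner variations `z` of step size `t`. -/
def SlopeLE (F : Step N → ℝ) (F₀ a : ℝ) : Prop :=
  ∀ ε > 0, ∀ᶠ z in smallSteps N, F z ≤ F₀ + z.t * (a + ε)

lemma HasSlope.neg (hF : HasSlope F F₀ a) : HasSlope (fun z => -F z) (-F₀) (-a) :=
  (Asymptotics.IsLittleO.neg_left hF).congr_left fun z => by ring

lemma HasSlope.slopeLE (hF : HasSlope F F₀ a) : SlopeLE F F₀ a := by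
  intro ε hε
  filter_upwards [Asymptotics.isLittleO_iff.1 hF hε] with z hz
  rw [Real.norm_of_nonneg z.t_pos.le] at hz
  linarith [(Real.le_norm_self _).trans hz]

lemma SlopeLE.add (hF : SlopeLE F F₀ a) (hG : SlopeLE G G₀ b) :
    SlopeLE (fun z => F z + G z) (F₀ + G₀) (a + b) := by
  intro ε hε
  filter_upwards [hF (ε / 2) (half_pos hε), hG (ε / 2) (half_pos hε)] with z h₁ h₂
  linarith

lemma SlopeLE.const_mul {c : ℝ} (hc : 0 ≤ c) (hF : c ≠ 0 → SlopeLE F F₀ a) :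
    SlopeLE (fun z => c * F z) (c * F₀) (c * a) := by
  intro ε hε
  rcases hc.eq_or_lt with rfl | hc
  · exact Eventually.of_forall fun z => by simpa using mul_nonneg z.t_pos.le hε.le
  · filter_upwards [hF hc.ne' (ε / c) (div_pos hε hc)] with z hz
    calc c * F z ≤ c * (F₀ + z.t * (a + ε / c)) := by gcongr
      _ = c * F₀ + z.t * (c * a + ε) := by field_simp

lemma SlopeLE.mono_slope (hF : SlopeLE F F₀ a) (hab : a ≤ b) : SlopeLE F F₀ b := by
  intro ε hε
  filter_upwards [hF ε hε] with z hz
  have ht := z.t_pos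
  exact hz.trans (by gcongr)

lemma SlopeLE.mono (hF : SlopeLE F F₀ a) (h : ∀ z, G z - G₀ ≤ F z - F₀) : SlopeLE G G₀ a := by
  intro ε hε
  filter_upwards [hF ε hε] with z hz
  linarith [h z]

lemma SlopeLE.nonneg (hF : SlopeLE F F₀ a) (h : ∀ z, F z = F₀) : 0 ≤ a := by
  refine le_of_forall_pos_le_add fun ε hε => ?_
  obtain ⟨z, hz⟩ := (hF ε hε).exists
  rw [h] at hz
  exact nonneg_of_mul_nonneg_right (le_add_iff_nonneg_right F₀ |>.1 hz) z.t_pos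

lemma hasSlope_one_sub_t_rpow (m : ℝ) : HasSlope (fun z : Step N => (1 - z.t) ^ m) 1 (-m) := by
  have hderiv : HasDerivAt (fun t : ℝ => (1 - t) ^ m) (-m) 0 := by
    simpa using ((hasDerivAt_id (0 : ℝ)).const_sub 1).rpow_const (p := m) (Or.inl (by simp))
  have hlittle := (hasDerivAt_iff_isLittleO.1 hderiv).comp_tendsto
    (tendsto_t_smallSteps (N := N) |>.mono_right nhdsWithin_le_nhds)
  simpa [HasSlope, Function.comp_def] using hlittle

lemma hasSlope_ratio_rpow (K : ℝ) :
    HasSlope (fun z : Step N => (z.deform.ratio : ℝ) ^ K) 1 (-(dilLip N * K)) := by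
  have hderiv : HasDerivAt (fun t : ℝ => (1 - t * dilLip N) ^ K) (-(dilLip N * K)) 0 := by
    simpa using (((hasDerivAt_id (0 : ℝ)).mul_const (dilLip N : ℝ)).const_sub 1).rpow_const
      (p := K) (Or.inl (by simp))
  have hlittle := (hasDerivAt_iff_isLittleO.1 hderiv).comp_tendsto
    (tendsto_t_smallSteps (N := N) |>.mono_right nhdsWithin_le_nhds)
  simpa [HasSlope, Function.comp_def, Step.ratio_deform] using hlittle

end Slope

section Scaling

variable {α β : Type*} {N : ℕ}

/-- The densities `e z` obtained from `e₀ ≥ 0` by the inner variations `z` scale like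
`x ↦ (1 - t) x` with degree `m` on the sets `S R`, and are comparable with `e₀` everywhere, up to
a power of the bi-Lipschitz constant of the variation. -/
structure ScalesWithDegree (S : ℝ → Set α) (e : Step N → α → ℝ) (e₀ : α → ℝ) (m : ℝ) : Prop where
  nonneg : ∀ x, 0 ≤ e₀ x
  eq_of_mem : ∀ z, ∀ x ∈ S z.R, e z x = (1 - z.t) ^ m * e₀ x
  exists_bounds : ∃ K : ℝ, 0 ≤ K ∧ ∀ z x,
    (z.deform.ratio : ℝ) ^ K * e₀ x ≤ e z x ∧ e z x ≤ ((z.deform.ratio : ℝ) ^ K)⁻¹ * e₀ x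

lemma rpow_le_rpow_and_rpow_le {c r s : ℝ} (hc : 0 < c) (hc₁ : c ≤ 1) (hr : 0 ≤ r) (h₁ : c * r ≤ s)
    (h₂ : s ≤ c⁻¹ * r) (k : ℝ) : c ^ |k| * r ^ k ≤ s ^ k ∧ s ^ k ≤ (c ^ |k|)⁻¹ * r ^ k := by
  have hpow : 0 < c ^ |k| := Real.rpow_pos_of_pos hc _
  rcases hr.eq_or_lt with rfl | hr
  · obtain rfl : s = 0 := by linarith
    have hzero : (0 : ℝ) ≤ 0 ^ k := Real.rpow_nonneg le_rfl k
    have hpow₁ : c ^ |k| ≤ 1 := Real.rpow_le_one hc.le hc₁ (abs_nonneg k)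
    exact ⟨mul_le_of_le_one_left hzero hpow₁,
      le_mul_of_one_le_left hzero ((one_le_inv₀ hpow).2 hpow₁)⟩
  · have hs : 0 < s := (mul_pos hc hr).trans_le h₁
    have hlow : (c * r) ^ k = c ^ k * r ^ k := Real.mul_rpow hc.le hr.le
    have hupp : (c⁻¹ * r) ^ k = (c ^ k)⁻¹ * r ^ k := by
      rw [Real.mul_rpow (inv_nonneg.2 hc.le) hr.le, Real.inv_rpow hc.le]
    rcases le_total 0 k with hk | hk
    · rw [abs_of_nonneg hk, ← hlow, ← hupp]
      exact ⟨Real.rpow_le_rpow (by positivity) h₁ hk, Real.rpow_le_rpow hs.le h₂ hk⟩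
    · rw [abs_of_nonpos hk, Real.rpow_neg hc.le, inv_inv, ← hlow, ← hupp]
      exact ⟨Real.rpow_le_rpow_of_nonpos hs h₂ hk,
        Real.rpow_le_rpow_of_nonpos (mul_pos hc hr) h₁ hk⟩

namespace ScalesWithDegree

variable {S : ℝ → Set α} {e f : Step N → α → ℝ} {e₀ f₀ : α → ℝ} {m k : ℝ}

lemma const (h₀ : ∀ x, 0 ≤ e₀ x) : ScalesWithDegree S (fun _ : Step N => e₀) e₀ 0 where
  nonneg := h₀
  eq_of_mem z x _ := by rw [Real.rpow_zero, one_mul]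
  exists_bounds := ⟨0, le_rfl, fun z x => by simp⟩

lemma mul (he : ScalesWithDegree S e e₀ m) (hf : ScalesWithDegree S f f₀ k) :
    ScalesWithDegree S (fun z x => e z x * f z x) (fun x => e₀ x * f₀ x) (m + k) where
  nonneg x := mul_nonneg (he.nonneg x) (hf.nonneg x)
  eq_of_mem z x hx := by
    rw [he.eq_of_mem z x hx, hf.eq_of_mem z x hx, Real.rpow_add z.one_sub_t_pos, mul_mul_mul_comm]
  exists_bounds := by
    obtain ⟨K, hK, hbe⟩ := he.exists_bounds
    obtain ⟨L, hL, hbf⟩ := hf.exists_bounds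
    refine ⟨K + L, add_nonneg hK hL, fun z x => ?_⟩
    have he₀ := he.nonneg x
    have hf₀ := hf.nonneg x
    have hfz : 0 ≤ f z x := le_trans (by positivity) (hbf z x).1
    have hez : 0 ≤ e z x := le_trans (by positivity) (hbe z x).1
    rw [Real.rpow_add (NNReal.coe_pos.2 z.deform.ratio_pos), mul_inv,
      mul_mul_mul_comm (_ ^ K), mul_mul_mul_comm (_ ^ K)⁻¹]
    exact ⟨mul_le_mul (hbe z x).1 (hbf z x).1 (by positivity) hez,
      mul_le_mul (hbe z x).2 (hbf z x).2 hfz (by positivity)⟩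

lemma rpow (he : ScalesWithDegree S e e₀ m) (k : ℝ) :
    ScalesWithDegree S (fun z x => e z x ^ k) (fun x => e₀ x ^ k) (m * k) where
  nonneg x := Real.rpow_nonneg (he.nonneg x) k
  eq_of_mem z x hx := by
    rw [he.eq_of_mem z x hx, Real.mul_rpow (Real.rpow_nonneg z.one_sub_t_pos.le m) (he.nonneg x),
      ← Real.rpow_mul z.one_sub_t_pos.le]
  exists_bounds := by
    obtain ⟨K, hK, hbe⟩ := he.exists_bounds
    refine ⟨K * |k|, mul_nonneg hK (abs_nonneg k), fun z x => ?_⟩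
    rw [Real.rpow_mul z.deform.ratio.coe_nonneg]
    exact rpow_le_rpow_and_rpow_le (Real.rpow_pos_of_pos z.deform.ratio_pos K)
      (Real.rpow_le_one z.deform.ratio.coe_nonneg z.deform.ratio_le_one hK) (he.nonneg x)
      (hbe z x).1 (hbe z x).2 k

lemma comp (he : ScalesWithDegree S e e₀ m) (g : β → α) :
    ScalesWithDegree (fun R => g ⁻¹' S R) (fun z x => e z (g x)) (fun x => e₀ (g x)) m where
  nonneg x := he.nonneg (g x)
  eq_of_mem z x hx := he.eq_of_mem z (g x) hx
  exists_bounds := he.exists_bounds.imp fun _ h => ⟨h.1, fun z x => h.2 z (g x)⟩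

lemma anti (he : ScalesWithDegree S e e₀ m) {T : ℝ → Set α} (h : ∀ R, T R ⊆ S R) :
    ScalesWithDegree T e e₀ m where
  nonneg := he.nonneg
  eq_of_mem z x hx := he.eq_of_mem z x (h _ hx)
  exists_bounds := he.exists_bounds

lemma exists_abs_sub_le (he : ScalesWithDegree S e e₀ m) :
    ∃ C, 0 ≤ C ∧ ∀ᶠ z in smallSteps N, ∀ x, |e z x - (1 - z.t) ^ m * e₀ x| ≤ C * z.t * e₀ x := by
  obtain ⟨K, -, hK⟩ := he.exists_bounds
  have hO : ∀ k : ℝ, (fun z : Step N => (z.deform.ratio : ℝ) ^ k - (1 - z.t) ^ m)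
      =O[smallSteps N] fun z => z.t := fun k => by
    have hdiff := ((hasSlope_ratio_rpow (N := N) k).sub (hasSlope_one_sub_t_rpow m)).isBigO.add
      ((Asymptotics.isBigO_refl Step.t (smallSteps N)).const_mul_left (-(dilLip N * k) + m))
    exact hdiff.congr_left fun z => by ring
  obtain ⟨C, hC, h₁⟩ := (hO K).exists_nonneg
  obtain ⟨C', h₂⟩ := (hO (-K)).bound
  refine ⟨max C C', le_max_of_le_left hC, ?_⟩
  filter_upwards [h₁.bound, h₂] with z hlow hupp x
  have he₀ := he.nonneg x
  have ht := z.t_pos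
  rw [Real.norm_of_nonneg ht.le, Real.norm_eq_abs] at hlow hupp
  rw [Real.rpow_neg z.deform.ratio.coe_nonneg] at hupp
  have hmax : ∀ {c d : ℝ}, |c| ≤ d * z.t → d ≤ max C C' → |c| * e₀ x ≤ max C C' * z.t * e₀ x :=
    fun hc hd => by gcongr; exact hc.trans (by gcongr)
  refine abs_sub_le_iff.2 ⟨?_, ?_⟩
  · refine le_trans ?_ (hmax hupp (le_max_right _ _))
    refine le_trans ?_ (mul_le_mul_of_nonneg_right (le_abs_self _) he₀)
    linarith [(hK z x).2]
  · refine le_trans ?_ (hmax hlow (le_max_left _ _))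
    refine le_trans ?_ (mul_le_mul_of_nonneg_right (neg_le_abs _) he₀)
    linarith [(hK z x).1]

variable [MeasurableSpace α] {μ : Measure α}

lemma integrable (he : ScalesWithDegree S e e₀ m) (he₀ : Integrable e₀ μ)
    (hm : ∀ z, AEStronglyMeasurable (e z) μ) (z : Step N) : Integrable (e z) μ := by
  obtain ⟨K, -, hK⟩ := he.exists_bounds
  refine (he₀.const_mul ((z.deform.ratio : ℝ) ^ K)⁻¹).mono' (hm z) (.of_forall fun x => ?_)
  have hnn : 0 ≤ e z x :=
    le_trans (mul_nonneg (Real.rpow_nonneg z.deform.ratio.coe_nonneg K) (he.nonneg x)) (hK z x).1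
  exact (Real.norm_of_nonneg hnn).trans_le (hK z x).2

end ScalesWithDegree

variable [MeasurableSpace α] {μ : Measure α} {S : ℝ → Set α}

lemma tendsto_setIntegral_compl_of_ae_eventually_mem {E : Type*} [NormedAddCommGroup E]
    [NormedSpace ℝ E] {f : α → E} (hf : Integrable f μ) (hS : ∀ R, MeasurableSet (S R))
    (hev : ∀ᵐ x ∂μ, ∀ᶠ R in atTop, x ∈ S R) :
    Tendsto (fun R => ∫ x in (S R)ᶜ, f x ∂μ) atTop (𝓝 0) := by
  have hlim := tendsto_integral_filter_of_dominated_convergence (μ := μ) (l := atTop)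
    (F := fun R => (S R)ᶜ.indicator f) (f := fun _ => 0) (fun x => ‖f x‖)
    (Eventually.of_forall fun R => hf.aestronglyMeasurable.indicator (hS R).compl)
    (Eventually.of_forall fun R => Eventually.of_forall fun x => norm_indicator_le_norm_self _ _)
    hf.norm (by
      filter_upwards [hev] with x hx
      refine tendsto_const_nhds.congr' ?_
      filter_upwards [hx] with R hR
      rw [Set.indicator_of_notMem (Set.notMem_compl_iff.2 hR)])
  simpa only [integral_indicator (hS _).compl, integral_zero] using hlim

theorem ScalesWithDegree.hasSlope_integral {e : Step N → α → ℝ} {e₀ : α → ℝ} {m : ℝ}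
    (he : ScalesWithDegree S e e₀ m) (he₀ : Integrable e₀ μ)
    (hm : ∀ z, AEStronglyMeasurable (e z) μ) (hS : ∀ R, MeasurableSet (S R))
    (hev : ∀ᵐ x ∂μ, ∀ᶠ R in atTop, x ∈ S R) :
    HasSlope (fun z => ∫ x, e z x ∂μ) (∫ x, e₀ x ∂μ) (-(m * ∫ x, e₀ x ∂μ)) := by
  obtain ⟨C, hC, hbound⟩ := he.exists_abs_sub_le
  have hmain : (fun z : Step N => ((1 - z.t) ^ m - 1 - z.t * -m) * ∫ x, e₀ x ∂μ)
      =o[smallSteps N] fun z => z.t :=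
    (Asymptotics.IsLittleO.const_mul_left (hasSlope_one_sub_t_rpow m) _).congr_left
      fun z => mul_comm _ _
  -- the exact scaling on `S R` confines the error to the complement
  have herror : (fun z : Step N => ∫ x, (e z x - (1 - z.t) ^ m * e₀ x) ∂μ)
      =o[smallSteps N] fun z => z.t := by
    have hsmall := ((tendsto_setIntegral_compl_of_ae_eventually_mem he₀ hS hev).comp
      (tendsto_R_smallSteps (N := N))).const_mul C
    rw [mul_zero] at hsmall
    refine Asymptotics.IsBigO.trans_isLittleO (.of_bound 1 ?_)
      (((Asymptotics.isLittleO_one_iff ℝ).2 hsmall).mul_isBigO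
        (Asymptotics.isBigO_refl Step.t _) |>.congr_right fun z => one_mul _)
    filter_upwards [hbound] with z hz
    rw [one_mul, ← setIntegral_eq_integral_of_forall_compl_eq_zero (s := (S z.R)ᶜ) fun x hx => by
      rw [he.eq_of_mem z x (Set.not_notMem.1 hx), sub_self]]
    refine (norm_integral_le_of_norm_le (he₀.integrableOn.const_mul (C * z.t))
      (Eventually.of_forall hz)).trans_eq ?_
    have hnn : 0 ≤ ∫ x in (S z.R)ᶜ, e₀ x ∂μ := integral_nonneg he.nonneg
    have ht := z.t_pos
    rw [integral_const_mul, Function.comp_apply, Real.norm_of_nonneg (by positivity)]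
    ring
  refine (hmain.add herror).congr_left fun z => ?_
  rw [integral_sub (he.integrable he₀ hm z) (he₀.const_mul _), integral_const_mul]
  ring

theorem ScalesWithDegree.hasSlope_integral_of_isJacobian {φ : Step N → α ≃ᵐ α}
    {J : Step N → α → ℝ≥0} {e : Step N → α → ℝ} {e₀ : α → ℝ} {m : ℝ}
    (he : ScalesWithDegree S (fun z x => J z x * e z (φ z x)) e₀ m)
    (hJ : ∀ z, IsJacobian μ (φ z) (J z)) (he₀ : Integrable e₀ μ)
    (hm : ∀ z, AEStronglyMeasurable (e z) μ) (hS : ∀ R, MeasurableSet (S R))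
    (hev : ∀ᵐ x ∂μ, ∀ᶠ R in atTop, x ∈ S R) :
    (∀ z, Integrable (e z) μ) ∧
      HasSlope (fun z => ∫ x, e z x ∂μ) (∫ x, e₀ x ∂μ) (-(m * ∫ x, e₀ x ∂μ)) := by
  have hmJ : ∀ z, AEStronglyMeasurable (fun x => J z x * e z (φ z x)) μ := fun z =>
    (hJ z).measurable.coe_nnreal_real.aestronglyMeasurable.mul
      ((hm z).comp_quasiMeasurePreserving (hJ z).quasiMeasurePreserving)
  refine ⟨fun z => (hJ z).integrable_iff.2 (he.integrable he₀ hmJ z), ?_⟩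
  have hint : ∀ z, ∫ x, e z x ∂μ = ∫ x, J z x * e z (φ z x) ∂μ := fun z => (hJ z).integral_eq _
  simpa only [hint] using he.hasSlope_integral he₀ hmJ hS hev

end Scaling

section Energies

variable {N : ℕ}

lemma scalesWithDegree_jac :
    ScalesWithDegree (core N) (fun z x => (z.deform.jac x : ℝ)) (fun _ => 1) N where
  nonneg _ := zero_le_one
  eq_of_mem z x hx := by rw [z.jac_deform_of_mem_core hx, Real.rpow_natCast, mul_one]
  exists_bounds := by
    refine ⟨N, N.cast_nonneg, fun z x => ?_⟩
    rw [Real.rpow_natCast, mul_one, mul_one, ← inv_pow]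
    exact ⟨mod_cast z.deform.ratio_pow_le_jac x, mod_cast z.deform.jac_le x⟩

lemma scalesWithDegree_norm_deform_sub :
    ScalesWithDegree (fun R => core N R ×ˢ core N R)
      (fun z x => ‖z.deform.toHomeo x.1 - z.deform.toHomeo x.2‖) (fun x => ‖x.1 - x.2‖) 1 where
  nonneg _ := norm_nonneg _
  eq_of_mem z x hx := by
    rw [z.deform_of_mem_core hx.1, z.deform_of_mem_core hx.2, ← smul_sub, norm_smul,
      Real.norm_of_nonneg z.one_sub_t_pos.le, Real.rpow_one]
  exists_bounds := by
    refine ⟨1, zero_le_one, fun z x => ?_⟩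
    rw [Real.rpow_one]
    exact ⟨z.deform.le_norm_toHomeo_sub _ _, z.deform.norm_toHomeo_sub_le _ _⟩

lemma scalesWithDegree_norm_deform :
    ScalesWithDegree (core N) (fun z x => ‖z.deform.toHomeo x‖) (fun x => ‖x‖) 1 where
  nonneg _ := norm_nonneg _
  eq_of_mem z x hx := by
    rw [z.deform_of_mem_core hx, norm_smul, Real.norm_of_nonneg z.one_sub_t_pos.le, Real.rpow_one]
  exists_bounds := by
    refine ⟨1, zero_le_one, fun z x => ?_⟩
    rw [Real.rpow_one]
    simpa [z.deform_zero] using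
      And.intro (z.deform.le_norm_toHomeo_sub x 0) (z.deform.norm_toHomeo_sub_le x 0)

lemma Step.norm_pullGrad_of_mem_core (z : Step N) (G : E N → E N) {x : E N}
    (hx : x ∈ core N z.R) :
    ‖z.deform.pullGrad G (z.deform.toHomeo x)‖ = (1 - z.t)⁻¹ * ‖G x‖ := by
  rw [← z.deform.adjoint_pullGrad G x, z.fderiv_deform_of_mem_core hx,
    LinearIsometryEquiv.map_smulₛₗ, ContinuousLinearMap.adjoint_id]
  simp [norm_smul, abs_of_pos z.one_sub_t_pos, z.one_sub_t_pos.ne']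

lemma scalesWithDegree_norm_pullGrad (G : E N → E N) :
    ScalesWithDegree (core N) (fun z x => ‖z.deform.pullGrad G (z.deform.toHomeo x)‖)
      (fun x => ‖G x‖) (-1) where
  nonneg _ := norm_nonneg _
  eq_of_mem z x hx := by rw [z.norm_pullGrad_of_mem_core G hx, Real.rpow_neg_one]
  exists_bounds := by
    refine ⟨1, zero_le_one, fun z x => ?_⟩
    rw [Real.rpow_one]
    refine ⟨z.deform.le_norm_pullGrad G x, ?_⟩
    simpa using z.deform.norm_pullGrad_le G (z.deform.toHomeo x)

lemma ae_eventually_mem_core [NeZero N] : ∀ᵐ x : E N, ∀ᶠ R in atTop, x ∈ core N R := by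
  have : Nontrivial (E N) := ⟨⟨EuclideanSpace.single 0 1, 0, by simp⟩⟩
  filter_upwards [Measure.ae_ne volume (0 : E N)] with x hx using eventually_mem_core hx

/-- The function `u` transported by the inner variation `z`. -/
def Step.transport (z : Step N) (u : E N → ℝ) (y : E N) : ℝ := u (z.deform.toHomeo.symm y)

lemma Step.transport_deform (z : Step N) (u : E N → ℝ) (x : E N) :
    z.transport u (z.deform.toHomeo x) = u x := by
  rw [transport, Homeomorph.symm_apply_apply]

theorem hasSlope_weighted [NeZero N] {u : E N → ℝ} (hu : AEStronglyMeasurable u volume) {α p : ℝ}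
    (he : Integrable (fun x : E N => ‖x‖ ^ α * |u x| ^ p) volume) :
    (∀ z : Step N, Integrable (fun y => ‖y‖ ^ α * |z.transport u y| ^ p) volume) ∧
      HasSlope (fun z : Step N => ∫ y, ‖y‖ ^ α * |z.transport u y| ^ p)
        (∫ x : E N, ‖x‖ ^ α * |u x| ^ p) (-((N + α) * ∫ x : E N, ‖x‖ ^ α * |u x| ^ p)) := by
  have hscale := scalesWithDegree_jac.mul ((scalesWithDegree_norm_deform.rpow α).mul
    (.const fun x : E N => Real.rpow_nonneg (abs_nonneg (u x)) p))
  simp only [one_mul, add_zero] at hscale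
  refine ScalesWithDegree.hasSlope_integral_of_isJacobian
    (φ := fun z : Step N => z.deform.toHomeo.toMeasurableEquiv) (J := fun z => z.deform.jac)
    (by simpa [Step.transport_deform] using hscale) (fun z => z.deform.isJacobian) he (fun z => ?_)
    (fun R => (isOpen_core R).measurableSet) ae_eventually_mem_core
  have hut := z.deform.aestronglyMeasurable_comp_symm hu
  exact (measurable_norm.pow_const α).aestronglyMeasurable.mul
    (hut.norm.aemeasurable.pow_const p).aestronglyMeasurable

theorem hasSlope_gagliardo [NeZero N] {u : E N → ℝ} (hu : AEStronglyMeasurable u volume) {p d : ℝ}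
    (he : Integrable (fun x : E N × E N => |u x.1 - u x.2| ^ p / ‖x.1 - x.2‖ ^ d)
      (volume.prod volume)) :
    (∀ z : Step N, Integrable (fun y : E N × E N =>
        |z.transport u y.1 - z.transport u y.2| ^ p / ‖y.1 - y.2‖ ^ d) (volume.prod volume)) ∧
      HasSlope (fun z : Step N => ∫ y : E N × E N,
          |z.transport u y.1 - z.transport u y.2| ^ p / ‖y.1 - y.2‖ ^ d ∂(volume.prod volume))
        (∫ x : E N × E N, |u x.1 - u x.2| ^ p / ‖x.1 - x.2‖ ^ d ∂(volume.prod volume))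
        (-((2 * N - d) *
          ∫ x : E N × E N, |u x.1 - u x.2| ^ p / ‖x.1 - x.2‖ ^ d ∂(volume.prod volume))) := by
  simp only [div_eq_mul_inv, ← Real.rpow_neg (norm_nonneg _)] at he ⊢
  have hjac := ((scalesWithDegree_jac (N := N)).comp Prod.fst).anti
    (T := fun R => core N R ×ˢ core N R) fun R x hx => hx.1
  have hjac' := ((scalesWithDegree_jac (N := N)).comp Prod.snd).anti
    (T := fun R => core N R ×ˢ core N R) fun R x hx => hx.2
  have hscale := (hjac.mul hjac').mul ((ScalesWithDegree.const fun x : E N × E N =>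
    Real.rpow_nonneg (abs_nonneg (u x.1 - u x.2)) p).mul
      (scalesWithDegree_norm_deform_sub.rpow (-d)))
  simp only [one_mul, zero_add, ← two_mul] at hscale
  rw [← sub_eq_add_neg] at hscale
  have happ : ∀ (z : Step N) x, z.deform.toHomeo.toMeasurableEquiv.prodCongr
      z.deform.toHomeo.toMeasurableEquiv x = (z.deform.toHomeo x.1, z.deform.toHomeo x.2) :=
    fun _ _ => rfl
  have hcore : ∀ᵐ x : E N × E N ∂(volume.prod volume),
      ∀ᶠ R in atTop, x ∈ core N R ×ˢ core N R := by
    filter_upwards [Measure.quasiMeasurePreserving_fst.ae (ae_eventually_mem_core (N := N)),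
      Measure.quasiMeasurePreserving_snd.ae (ae_eventually_mem_core (N := N))] with x h₁ h₂
      using h₁.and h₂
  refine ScalesWithDegree.hasSlope_integral_of_isJacobian
    (φ := fun z : Step N => z.deform.toHomeo.toMeasurableEquiv.prodCongr
      z.deform.toHomeo.toMeasurableEquiv) (J := fun z x => z.deform.jac x.1 * z.deform.jac x.2)
    (by simpa [Step.transport_deform, happ] using hscale) (fun z => z.deform.isJacobian.prod) he
    (fun z => ?_) (fun R => (isOpen_core R).measurableSet.prod (isOpen_core R).measurableSet) hcore
  have hut := z.deform.aestronglyMeasurable_comp_symm hu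
  exact ((hut.comp_fst.sub hut.comp_snd).norm.aemeasurable.pow_const p).aestronglyMeasurable.mul
    ((measurable_fst.sub measurable_snd).norm.pow_const (-d)).aestronglyMeasurable

theorem hasSlope_dirichlet [NeZero N] {G : E N → E N} (hG : AEStronglyMeasurable G volume) {p : ℝ}
    (he : Integrable (fun x : E N => ‖G x‖ ^ p) volume) :
    (∀ z : Step N, Integrable (fun y => ‖z.deform.pullGrad G y‖ ^ p) volume) ∧
      HasSlope (fun z : Step N => ∫ y, ‖z.deform.pullGrad G y‖ ^ p) (∫ x, ‖G x‖ ^ p)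
        (-((N - p) * ∫ x, ‖G x‖ ^ p)) := by
  have hscale := scalesWithDegree_jac.mul ((scalesWithDegree_norm_pullGrad G).rpow p)
  simp only [one_mul, neg_one_mul, ← sub_eq_add_neg] at hscale
  refine ScalesWithDegree.hasSlope_integral_of_isJacobian
    (φ := fun z : Step N => z.deform.toHomeo.toMeasurableEquiv) (J := fun z => z.deform.jac)
    hscale (fun z => z.deform.isJacobian) he (fun z => ?_)
    (fun R => (isOpen_core R).measurableSet) ae_eventually_mem_core
  exact ((z.deform.aestronglyMeasurable_pullGrad hG).norm.aemeasurable.pow_const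
    p).aestronglyMeasurable

end Energies

section Convexity

variable {N : ℕ} {p : ℝ}

lemma rpow_sub_two_mul_self (hp : 1 < p) {a : ℝ} (ha : 0 ≤ a) :
    a ^ (p - 2) * a = a ^ (p - 1) := by
  rcases ha.eq_or_lt with rfl | ha
  · rw [mul_zero, Real.zero_rpow (sub_ne_zero.2 hp.ne')]
  · rw [← Real.rpow_add_one ha.ne']
    ring_nf

lemma rpow_sub_one_mul_self (hp : 1 < p) {a : ℝ} (ha : 0 ≤ a) : a ^ (p - 1) * a = a ^ p := by
  rcases ha.eq_or_lt with rfl | ha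
  · rw [mul_zero, Real.zero_rpow (zero_lt_one.trans hp).ne']
  · rw [← Real.rpow_add_one ha.ne', sub_add_cancel]

lemma rpow_sub_one_mul_sub_le (hp : 1 < p) {a b : ℝ} (ha : 0 ≤ a) (hb : 0 ≤ b) :
    a ^ (p - 1) * b - a ^ p ≤ (b ^ p - a ^ p) / p := by
  have hyoung := Real.young_inequality_of_nonneg (Real.rpow_nonneg ha (p - 1)) hb
    (Real.HolderConjugate.conjExponent hp).symm
  have hp₁ : p - 1 ≠ 0 := sub_ne_zero.2 hp.ne'
  rw [← Real.rpow_mul ha, Real.conjExponent, mul_div_cancel₀ p hp₁] at hyoung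
  calc a ^ (p - 1) * b - a ^ p ≤ a ^ p / (p / (p - 1)) + b ^ p / p - a ^ p := by gcongr
    _ = (b ^ p - a ^ p) / p := by field_simp; ring

lemma inner_PhiVec_self (hp : 1 < p) (ξ : E N) : inner ℝ (PhiVec p ξ) ξ = ‖ξ‖ ^ p := by
  rw [PhiVec, real_inner_smul_left, real_inner_self_eq_norm_mul_norm, ← mul_assoc,
    rpow_sub_two_mul_self hp (norm_nonneg ξ), rpow_sub_one_mul_self hp (norm_nonneg ξ)]

lemma Phi_mul_self (hp : 1 < p) (a : ℝ) : Phi p a * a = |a| ^ p := by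
  rw [Phi, mul_assoc, ← abs_mul_abs_self a, ← mul_assoc, rpow_sub_two_mul_self hp (abs_nonneg a),
    rpow_sub_one_mul_self hp (abs_nonneg a)]

lemma inner_PhiVec_sub_le (hp : 1 < p) (ξ ζ : E N) :
    inner ℝ (PhiVec p ξ) ζ - ‖ξ‖ ^ p ≤ (‖ζ‖ ^ p - ‖ξ‖ ^ p) / p := by
  refine (sub_le_sub_right ?_ _).trans
    (rpow_sub_one_mul_sub_le hp (norm_nonneg ξ) (norm_nonneg ζ))
  calc inner ℝ (PhiVec p ξ) ζ ≤ ‖PhiVec p ξ‖ * ‖ζ‖ := real_inner_le_norm _ _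
    _ = ‖ξ‖ ^ (p - 1) * ‖ζ‖ := by
      rw [PhiVec, norm_smul, Real.norm_of_nonneg (Real.rpow_nonneg (norm_nonneg ξ) _),
        rpow_sub_two_mul_self hp (norm_nonneg ξ)]

lemma Phi_mul_sub_le (hp : 1 < p) (a b : ℝ) :
    Phi p a * b - |a| ^ p ≤ (|b| ^ p - |a| ^ p) / p := by
  refine (sub_le_sub_right ?_ _).trans (rpow_sub_one_mul_sub_le hp (abs_nonneg a) (abs_nonneg b))
  calc Phi p a * b ≤ |Phi p a * b| := le_abs_self _
    _ = |a| ^ (p - 1) * |b| := by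
      rw [Phi, abs_mul, abs_mul, Real.abs_rpow_of_nonneg (abs_nonneg a), abs_abs,
        rpow_sub_two_mul_self hp (abs_nonneg a)]

lemma neg_Phi_mul_sub_le (hp : 1 < p) (a b : ℝ) :
    -(Phi p a * b) + |a| ^ p ≤ -(|b| ^ p - |a| ^ p) / p + |Phi p b - Phi p a| * |b - a| := by
  have hconv := Phi_mul_sub_le hp b a
  have hself_a := Phi_mul_self hp a
  have hself_b := Phi_mul_self hp b
  have hmono : (Phi p b - Phi p a) * (b - a) ≤ |Phi p b - Phi p a| * |b - a| :=
    (le_abs_self _).trans (abs_mul _ _).le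
  rw [neg_sub]
  linarith

lemma SlopeLE.of_convex {α : Type*} [MeasurableSpace α] {μ : Measure α} {e : α → ℝ}
    {e' g : Step N → α → ℝ} {a : ℝ} (hp : 0 < p) (he : Integrable e μ)
    (he' : ∀ z, Integrable (e' z) μ) (hs : HasSlope (fun z => ∫ x, e' z x ∂μ) (∫ x, e x ∂μ) a)
    (hg : ∀ z, Integrable (g z) μ) (h : ∀ z, ∀ᵐ x ∂μ, g z x - e x ≤ (e' z x - e x) / p) :
    SlopeLE (fun z => ∫ x, g z x ∂μ) (∫ x, e x ∂μ) (1 / p * a) := by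
  refine (SlopeLE.const_mul (one_div_pos.2 hp).le fun _ => hs.slopeLE).mono fun z => ?_
  rw [← mul_sub, ← integral_sub (hg z) he, ← integral_sub (he' z) he, ← integral_const_mul]
  refine integral_mono_ae ((hg z).sub he) (((he' z).sub he).const_mul _) ?_
  filter_upwards [h z] with x hx
  rwa [one_div_mul_eq_div]

end Convexity

section Transport

variable {N : ℕ} {u : E N → ℝ} {p s β : ℝ}

lemma isRadial_transport (hu : IsRadial u) (z : Step N) : IsRadial (z.transport u) := by
  classical
  obtain ⟨g, hg⟩ := hu
  refine ⟨fun r => if h : ∃ y : E N, ‖y‖ = r then g ‖z.deform.toHomeo.symm h.choose‖ else 0, ?_⟩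
  filter_upwards [z.deform.isJacobian.quasiMeasurePreserving_symm.ae hg] with y hy
  have hex : ∃ x : E N, ‖x‖ = ‖y‖ := ⟨y, rfl⟩
  rw [dif_pos hex, z.norm_deform_symm_eq hex.choose_spec]
  exact hy

lemma memLp_iff_integrable_norm_rpow {G : E N → E N} (hp : 0 < p)
    (hG : AEStronglyMeasurable G volume) :
    MemLp G (ENNReal.ofReal p) volume ↔ Integrable (fun x => ‖G x‖ ^ p) volume := by
  rw [← integrable_norm_rpow_iff hG (ENNReal.ofReal_pos.2 hp).ne' ENNReal.ofReal_ne_top,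
    ENNReal.toReal_ofReal hp.le]

lemma memW_transport [NeZero N] (hp : 0 < p) (hu : MemW s p β u) (z : Step N) :
    MemW s p β (z.transport u) := by
  obtain ⟨⟨hm, hw⟩, hf⟩ := hu
  refine ⟨⟨z.deform.aestronglyMeasurable_comp_symm hm, (hasSlope_weighted hm hw).1 z⟩, ?_⟩
  unfold FiniteSeminorm at hf ⊢
  split_ifs at hf ⊢ with hs
  · obtain ⟨hgrad, hLp⟩ := hf
    have hG := hLp.aestronglyMeasurable
    refine ⟨z.deform.hasWeakGradient_comp_symm hgrad,
      MemLp.ae_eq (z.deform.weakGrad_comp_symm hgrad).symm ?_⟩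
    exact (memLp_iff_integrable_norm_rpow hp (z.deform.aestronglyMeasurable_pullGrad hG)).2
      ((hasSlope_dirichlet hG ((memLp_iff_integrable_norm_rpow hp hG).1 hLp)).1 z)
  · exact (hasSlope_gagliardo hm hf).1 z

lemma memCalW_transport [NeZero N] {γ : ℝ} (hp : 0 < p) (hu : MemCalW γ s p β u) (z : Step N) :
    MemCalW γ s p β (z.transport u) :=
  ⟨memW_transport hp hu.1 z, isRadial_transport hu.2 z⟩

end Transport

section Pairings

variable {N : ℕ} {u : E N → ℝ} {p q s α β M : ℝ}

lemma localIntegrand_self (hp : 1 < p) : localIntegrand p u u = fun x => ‖weakGrad u x‖ ^ p :=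
  funext fun _ => inner_PhiVec_self hp _

lemma nonlocalIntegrand_self (hp : 1 < p) : nonlocalIntegrand s p u u =
    fun x => |u x.1 - u x.2| ^ p / ‖x.1 - x.2‖ ^ ((N : ℝ) + s * p) :=
  funext fun x => by rw [nonlocalIntegrand, Phi_mul_self hp]

lemma weighted_Phi_mul_self (hp : 1 < p) : (fun x : E N => ‖x‖ ^ β * Phi p (u x) * u x) =
    fun x => ‖x‖ ^ β * |u x| ^ p :=
  funext fun x => by rw [mul_assoc, Phi_mul_self hp]

lemma slopeLE_local [NeZero N] (hp : 1 < p) (hu : FiniteSeminorm 1 p u)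
    (hut : ∀ z : Step N, Integrable (localIntegrand p u (z.transport u)) volume) :
    SlopeLE (fun z => ∫ x, localIntegrand p u (z.transport u) x)
      (∫ x, localIntegrand p u u x) (-((N - p) / p * ∫ x, localIntegrand p u u x)) := by
  rw [FiniteSeminorm, if_pos rfl] at hu
  obtain ⟨hgrad, hLp⟩ := hu
  have hG := hLp.aestronglyMeasurable
  have he := (memLp_iff_integrable_norm_rpow (zero_lt_one.trans hp) hG).1 hLp
  obtain ⟨he', hslope⟩ := hasSlope_dirichlet hG he
  rw [localIntegrand_self hp]
  refine (SlopeLE.of_convex (zero_lt_one.trans hp) he he' hslope hut fun z => ?_).mono_slope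
    (by ring_nf; rfl)
  filter_upwards [z.deform.weakGrad_comp_symm hgrad] with x hx
  rw [← hx]
  exact inner_PhiVec_sub_le hp _ _

lemma slopeLE_nonlocal [NeZero N] (hp : 1 < p) (hm : AEStronglyMeasurable u volume)
    (hu : Integrable (nonlocalIntegrand s p u u) (volume.prod volume))
    (hut : ∀ z : Step N,
      Integrable (nonlocalIntegrand s p u (z.transport u)) (volume.prod volume)) :
    SlopeLE (fun z => ∫ x, nonlocalIntegrand s p u (z.transport u) x ∂(volume.prod volume))
      (∫ x, nonlocalIntegrand s p u u x ∂(volume.prod volume))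
      (-((N - s * p) / p * ∫ x, nonlocalIntegrand s p u u x ∂(volume.prod volume))) := by
  rw [nonlocalIntegrand_self hp] at hu ⊢
  obtain ⟨he', hslope⟩ := hasSlope_gagliardo hm hu
  refine (SlopeLE.of_convex (zero_lt_one.trans hp) hu he' hslope hut fun z =>
    Eventually.of_forall fun x => ?_).mono_slope (by ring_nf; rfl)
  rw [nonlocalIntegrand, ← sub_div, ← sub_div, div_right_comm]
  exact div_le_div_of_nonneg_right (Phi_mul_sub_le hp _ _) (Real.rpow_nonneg (norm_nonneg _) _)

lemma slopeLE_weighted [NeZero N] (hp : 1 < p) (hu : MemWeightedLp p β u)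
    (hut : ∀ z : Step N, Integrable (fun x => ‖x‖ ^ β * Phi p (u x) * z.transport u x) volume) :
    SlopeLE (fun z : Step N => ∫ x, ‖x‖ ^ β * Phi p (u x) * z.transport u x)
      (∫ x, ‖x‖ ^ β * Phi p (u x) * u x)
      (-((N + β) / p * ∫ x, ‖x‖ ^ β * Phi p (u x) * u x)) := by
  obtain ⟨he', hslope⟩ := hasSlope_weighted hu.1 hu.2
  rw [weighted_Phi_mul_self hp]
  refine (SlopeLE.of_convex (zero_lt_one.trans hp) hu.2 he' hslope hut fun z =>
    Eventually.of_forall fun x => ?_).mono_slope (by ring_nf; rfl)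
  rw [mul_assoc, ← mul_sub, ← mul_sub, mul_div_assoc]
  exact mul_le_mul_of_nonneg_left (Phi_mul_sub_le hp _ _) (Real.rpow_nonneg (norm_nonneg x) β)

lemma neg_integral_source_sub_le (hq : 1 < q) {z : Step N}
    (hu : Integrable (fun x : E N => ‖x‖ ^ α * |u x| ^ q) volume)
    (ht : Integrable (fun x => ‖x‖ ^ α * |z.transport u x| ^ q) volume)
    (hut : Integrable (fun x => ‖x‖ ^ α * Phi q (u x) * z.transport u x) volume)
    (hr : Integrable (z.remainder q α u) volume) :
    -(∫ x, ‖x‖ ^ α * Phi q (u x) * z.transport u x) + ∫ x, ‖x‖ ^ α * |u x| ^ q ≤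
      -((∫ x, ‖x‖ ^ α * |z.transport u x| ^ q) - ∫ x, ‖x‖ ^ α * |u x| ^ q) / q +
        ∫ x, z.remainder q α u x := by
  have hneg : Integrable (fun x => -(‖x‖ ^ α * Phi q (u x) * z.transport u x)) volume := hut.neg
  have hdiff : Integrable (fun x =>
      -(‖x‖ ^ α * |z.transport u x| ^ q - ‖x‖ ^ α * |u x| ^ q) / q) volume :=
    (ht.sub hu).neg.div_const q
  rw [← integral_neg, ← integral_add hneg hu, ← integral_sub ht hu, ← integral_neg,
    ← integral_div, ← integral_add hdiff hr]
  refine integral_mono (hneg.add hu) (hdiff.add hr) fun x => ?_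
  calc -(‖x‖ ^ α * Phi q (u x) * z.transport u x) + ‖x‖ ^ α * |u x| ^ q
      = ‖x‖ ^ α * (-(Phi q (u x) * z.transport u x) + |u x| ^ q) := by ring
    _ ≤ ‖x‖ ^ α * (-(|z.transport u x| ^ q - |u x| ^ q) / q +
        |Phi q (z.transport u x) - Phi q (u x)| * |z.transport u x - u x|) :=
      mul_le_mul_of_nonneg_left (neg_Phi_mul_sub_le hq _ _) (Real.rpow_nonneg (norm_nonneg x) α)
    _ = _ := by
      simp only [Step.remainder, Step.transport]
      ring

lemma slopeLE_neg_source [NeZero N] (hq : 1 < q) (hgrad : HasWeakGradient u)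
    (hM : ∀ᵐ x, |u x| ≤ M) (hu : Integrable (fun x : E N => ‖x‖ ^ α * Phi q (u x) * u x) volume)
    (hut : ∀ z : Step N, Integrable (fun x => ‖x‖ ^ α * Phi q (u x) * z.transport u x) volume) :
    SlopeLE (fun z : Step N => -∫ x, ‖x‖ ^ α * Phi q (u x) * z.transport u x)
      (-∫ x, ‖x‖ ^ α * Phi q (u x) * u x)
      ((N + α) / q * ∫ x, ‖x‖ ^ α * Phi q (u x) * u x) := by
  rw [weighted_Phi_mul_self hq] at hu ⊢
  have hloc := hgrad.isWeakGradient.1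
  obtain ⟨ht, hslope⟩ := hasSlope_weighted hloc.aestronglyMeasurable hu
  have hrem : HasSlope (fun z : Step N => ∫ y, z.remainder q α u y) 0 0 := by
    simpa [HasSlope] using integral_remainder_isLittleO hgrad.isWeakGradient hM hq α
  have hsum := (SlopeLE.const_mul (c := 1 / q) (by positivity) fun _ => hslope.neg.slopeLE).add
    hrem.slopeLE
  refine (hsum.mono fun z => ?_).mono_slope (by ring_nf; rfl)
  have hle := neg_integral_source_sub_le hq hu (ht z) (hut z) (z.integrable_remainder hloc hM hq α)
  rw [sub_neg_eq_add]
  refine hle.trans (le_of_eq ?_)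
  ring

end Pairings

section Pohozaev

variable {N : ℕ} {u : E N → ℝ} {γ s p q α β : ℝ}

/-- The order `σ` of the Sobolev space `𝒲 = W^{σ,p}` in which solutions are sought. -/
def spaceOrder (γ s : ℝ) : ℝ := if γ = 0 then s else 1

lemma le_spaceOrder (hs : s ≤ 1) : s ≤ spaceOrder γ s := by
  unfold spaceOrder
  split_ifs
  exacts [le_rfl, hs]

lemma spaceOrder_mul_lt (hγ : 0 ≤ γ) (hp : 0 < p) (hsN : s < (N : ℝ) / p)
    (hpN : 0 < γ → p < (N : ℝ)) : spaceOrder γ s * p < N := by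
  unfold spaceOrder
  split_ifs with h
  · exact (lt_div_iff₀ hp).1 hsN
  · rw [one_mul]
    exact hpN (hγ.lt_of_ne' h)

lemma critExp_eq : critExp N γ s p α = p * (N + α) / (N - spaceOrder γ s * p) := by
  unfold critExp spaceOrder
  split_ifs
  exacts [rfl, by rw [one_mul]]

lemma fracPairing_self_nonneg (hp : 1 < p) : 0 ≤ fracPairing s p u u := by
  unfold fracPairing
  split_ifs
  · rw [localIntegrand_self hp]
    positivity
  · rw [nonlocalIntegrand_self hp]
    positivity

lemma slopeLE_fracPairing [NeZero N] (hs : s ≤ 1) (hp : 1 < p) (hm : AEStronglyMeasurable u volume)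
    (hu : FiniteSeminorm (spaceOrder γ s) p u) (hc : FracPairingConverges s p u u)
    (hct : ∀ z : Step N, FracPairingConverges s p u (z.transport u)) :
    SlopeLE (fun z : Step N => fracPairing s p u (z.transport u)) (fracPairing s p u u)
      (-((N - spaceOrder γ s * p) / p * fracPairing s p u u)) := by
  have hslope : SlopeLE (fun z : Step N => fracPairing s p u (z.transport u))
      (fracPairing s p u u) (-((N - s * p) / p * fracPairing s p u u)) := by
    unfold FracPairingConverges at hc hct
    unfold fracPairing
    split_ifs at hc hct ⊢ with hs₁
    · rw [spaceOrder, hs₁, ite_self] at hu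
      rw [hs₁, one_mul]
      exact slopeLE_local hp hu hct
    · exact slopeLE_nonlocal hp hm hc hct
  refine hslope.mono_slope (neg_le_neg ?_)
  have hnonneg : 0 ≤ fracPairing s p u u := fracPairing_self_nonneg hp
  have hσ : s ≤ spaceOrder γ s := le_spaceOrder hs
  gcongr

lemma slopeLE_opPairing [NeZero N] (hγ₀ : 0 ≤ γ) (hγ₁ : γ ≤ 1) (hs : s ≤ 1) (hp : 1 < p)
    (hu : MemCalW γ s p β u) (hc : OpPairingConverges γ s p u u)
    (hct : ∀ z : Step N, OpPairingConverges γ s p u (z.transport u)) :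
    SlopeLE (fun z : Step N => opPairing γ s p u (z.transport u)) (opPairing γ s p u u)
      (-((N - spaceOrder γ s * p) / p * opPairing γ s p u u)) := by
  have hsemi : FiniteSeminorm (spaceOrder γ s) p u := hu.1.2
  have hlocal : γ ≠ 0 → SlopeLE (fun z : Step N => ∫ x, localIntegrand p u (z.transport u) x)
      (∫ x, localIntegrand p u u x)
      (-((N - spaceOrder γ s * p) / p * ∫ x, localIntegrand p u u x)) := fun hγ => by
    rw [spaceOrder, if_neg hγ] at hsemi
    rw [spaceOrder, if_neg hγ, one_mul]
    exact slopeLE_local hp hsemi fun z => (hct z).1 hγ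
  have hfrac : 1 - γ ≠ 0 → SlopeLE (fun z : Step N => fracPairing s p u (z.transport u))
      (fracPairing s p u u) (-((N - spaceOrder γ s * p) / p * fracPairing s p u u)) := fun hγ =>
    have hγ' : γ ≠ 1 := (sub_ne_zero.1 hγ).symm
    slopeLE_fracPairing hs hp hu.1.1.1 hsemi (hc.2 hγ') fun z => (hct z).2 hγ'
  unfold opPairing
  exact ((SlopeLE.const_mul hγ₀ hlocal).add
    (SlopeLE.const_mul (sub_nonneg.2 hγ₁) hfrac)).mono_slope (by ring_nf; rfl)

lemma exists_ae_abs_le (hu : MemLp u ∞ volume) : ∃ M : ℝ, ∀ᵐ x, |u x| ≤ M := by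
  refine ⟨(eLpNormEssSup u volume).toReal, ?_⟩
  have hfin : eLpNormEssSup u volume ≠ ⊤ := hu.eLpNorm_ne_top
  filter_upwards [ae_le_eLpNormEssSup (f := u) (μ := volume)] with x hx
  rw [← Real.norm_eq_abs, ← toReal_enorm]
  exact ENNReal.toReal_mono hfin hx

theorem pohozaev_inequality [NeZero N] (hγ₀ : 0 ≤ γ) (hγ₁ : γ ≤ 1) (hs : s ≤ 1) (hp : 1 < p)
    (hq : 1 < q) (hb : MemLp u ∞ volume) (hgrad : HasWeakGradient u)
    (hu : IsWeakSolution γ s p q α β u) :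
    (N - spaceOrder γ s * p) / p * opPairing γ s p u u +
        (N + β) / p * ∫ x : E N, ‖x‖ ^ β * Phi p (u x) * u x ≤
      (N + α) / q * ∫ x : E N, ‖x‖ ^ α * Phi q (u x) * u x := by
  obtain ⟨hmem, hsol⟩ := hu
  obtain ⟨hc, -, hA, heq⟩ := hsol u hmem
  have htest := fun z : Step N => hsol _ (memCalW_transport (zero_lt_one.trans hp) hmem z)
  obtain ⟨M, hM⟩ := exists_ae_abs_le hb
  have hop := slopeLE_opPairing hγ₀ hγ₁ hs hp hmem hc fun z => (htest z).1
  have hweight := slopeLE_weighted hp hmem.1.1 fun z => (htest z).2.1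
  have hsource := slopeLE_neg_source hq hgrad hM hA fun z => (htest z).2.2.1
  have hslope := ((hop.add hweight).add hsource).nonneg fun z => by
    rw [(htest z).2.2.2, heq, add_neg_cancel, add_neg_cancel]
  linarith

lemma ae_eq_zero_of_integral_weighted_eq_zero [NeZero N] (hq : 0 < q)
    (hu : Integrable (fun x : E N => ‖x‖ ^ α * |u x| ^ q) volume)
    (h : ∫ x : E N, ‖x‖ ^ α * |u x| ^ q = 0) : u =ᵐ[volume] 0 := by
  rw [integral_eq_zero_iff_of_nonneg (fun x => by positivity) hu] at h
  filter_upwards [h, Measure.ae_ne volume (0 : E N)] with x hx hx₀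
  have hpow : |u x| ^ q = 0 := (mul_eq_zero.1 hx).resolve_left
    (Real.rpow_pos_of_pos (norm_pos_iff.2 hx₀) α).ne'
  exact abs_eq_zero.1 ((Real.rpow_eq_zero (abs_nonneg _) hq.ne').1 hpow)

lemma lt_of_critExp_lt (hp : 0 < p) (hσ : spaceOrder γ s * p < N) (hs : s ≤ 1)
    (hα : -(s * p) < α) (hq : critExp N γ s p α < q) : p < q := by
  refine lt_of_le_of_lt ?_ hq
  have hsσ : s * p ≤ spaceOrder γ s * p := by
    have := le_spaceOrder (γ := γ) hs
    gcongr
  rw [critExp_eq, le_div_iff₀ (sub_pos.2 hσ)]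
  gcongr
  linarith

end Pohozaev

end

end MixedHenon

open MixedHenon in
theorem theorem1p3_general {N : ℕ} {γ s p q α β : ℝ} {u : E N → ℝ}
    (hγ₀ : 0 ≤ γ) (hγ₁ : γ ≤ 1) (hs₀ : 0 < s) (hs₁ : s ≤ 1) (hp : 1 < p) (hq₁ : 1 < q)
    (hsN : s < (N : ℝ) / p) (hpN : 0 < γ → p < (N : ℝ)) (hβ : -(s * p) ≤ β)
    (hq : critExp N γ s p α < q) (hb : MemLp u ∞ volume) (hgrad : HasWeakGradient u)
    (hsol : IsWeakSolution γ s p q α β u) : u =ᵐ[volume] 0 := by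
  have hp₀ : 0 < p := zero_lt_one.trans hp
  have hσN : spaceOrder γ s * p < N := spaceOrder_mul_lt hγ₀ hp₀ hsN hpN
  have hσ : s * p ≤ spaceOrder γ s * p := mul_le_mul_of_nonneg_right (le_spaceOrder hs₁) hp₀.le
  have : NeZero N := ⟨Nat.cast_ne_zero.1 ((mul_pos hs₀ hp₀).trans_le hσ |>.trans hσN).ne'⟩
  have hpohozaev := pohozaev_inequality hγ₀ hγ₁ hs₁ hp hq₁ hb hgrad hsol
  obtain ⟨-, -, hint, heq⟩ := hsol.2 u hsol.1
  rw [weighted_Phi_mul_self hp, weighted_Phi_mul_self hq₁] at hpohozaev heq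
  rw [weighted_Phi_mul_self hq₁] at hint
  refine ae_eq_zero_of_integral_weighted_eq_zero (zero_lt_one.trans hq₁) hint ?_
  set A := ∫ x : E N, ‖x‖ ^ α * |u x| ^ q
  set B := ∫ x : E N, ‖x‖ ^ β * |u x| ^ p
  have hA : 0 ≤ A := by positivity
  have hweight : (N - spaceOrder γ s * p) / p * B ≤ (N + β) / p * B := by
    gcongr
    linarith
  have hsupercritical : (N + α) / q < (N - spaceOrder γ s * p) / p := by
    rw [critExp_eq, div_lt_iff₀ (sub_pos.2 hσN)] at hq
    rw [div_lt_div_iff₀ (zero_lt_one.trans hq₁) hp₀]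
    linarith
  have hle : (N - spaceOrder γ s * p) / p * A ≤ (N + α) / q * A := by
    rw [← heq, mul_add, heq]
    linarith
  exact hA.antisymm' (not_lt.1 fun hpos => hle.not_gt (mul_lt_mul_of_pos_right hsupercritical hpos))

/-- Every weak solution in the class `MemX`, of whatever sign, vanishes almost everywhere; in
particular there is no positive one. In the presence of the local term (`γ > 0`) the critical
exponent is `p (N + α) / (N - p)`, so `p < N` is required there. -/
theorem theorem1p3 (N : ℕ) (γ s p q α β : ℝ)
    (hγ0 : 0 ≤ γ) (hγ1 : γ ≤ 1) (hs0 : 0 < s) (hs1 : s ≤ 1) (hp : 1 < p)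
    (hps : 1 / p < s) (hsN : s < (N : ℝ) / p) (hpN : 0 < γ → p < (N : ℝ))
    (hα : -(s * p) < α) (hβ : p * (1 - s) < β)
    (hq : MixedHenon.critExp N γ s p α < q) :
    ∀ u : MixedHenon.E N → ℝ, MixedHenon.MemX γ s p β u →
      MixedHenon.IsWeakSolution γ s p q α β u → u =ᵐ[volume] 0 := fun _ hu =>
  theorem1p3_general hγ0 hγ1 hs0 hs1 hp
    (hp.trans (MixedHenon.lt_of_critExp_lt (by linarith)
      (MixedHenon.spaceOrder_mul_lt hγ0 (by linarith) hsN hpN) hs1 hα hq))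
    hsN hpN (by nlinarith) hq hu.2.1 hu.2.2.1
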